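/- **Conventions.** $\mathbb N=\{1,2,\dots\}$ and $\mathbb Z_+=\{0,1,2,\dots\}$. For $\mathbf m\in\mathbb N^d$ let $\langle\mathbf m\rangle=\prod_k\{1,\dots,m_k\}$ be the box and $T(\mathbf m)=\prod_k\mathbb Z/m_k\mathbb Z$ the torus with side lengths $m_1,\dots,m_d$, and let $|\mathbf m|=m_1\cdots m_d$. A *dimer* in direction $k$ with initial point $\mathbf i$ occupies the two points $\mathbf i$ and $\mathbf i+\mathbf e_k$, which must be distinct; a *monomer* occupies one point. A dimer is determined by its initial point and its direction. Thus on a torus dimers may wrap around; if $m_k=2$ there are two different dimers in direction $k$ on the same pair of points, and if $m_k=1$ there are none in direction $k$. **Entropies.** Let $W(\mathbf m)$ be the set of monomer-dimer covers of $\langle\mathbf m\rangle$, i.e. the sets of monomers contained in $\langle\mathbf m\rangle$ and dimers of $\mathbb Z^d$ meeting $\langle\mathbf m\rangle$ (they may protrude out of it) such that every point of $\langle\mathbf m\rangle$ is occupied exactly once. Equivalently, $W(\mathbf m)$ is the set of colourings $\varphi$ of $\langle\mathbf m\rangle$ with the colours $1,\dots,2d+1$ such that, whenever $\mathbf i,\mathbf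 i+\mathbf e_k\in\langle\mathbf m\rangle$, one has $\varphi(\mathbf i)=k$ if and only if $\varphi(\mathbf i+\mathbf e_k)=k+d$. Let $\widetilde W(\mathbf m)\subseteq W(\mathbf m)$ be the set of covers without monomers (the colourings that do not use the colour $2d+1$). The monomer-dimer entropy and the dimer entropy are $$h_d=\lim_{m_1,\dots,m_d\to\infty}\frac{\log\#W(\mathbf m)}{|\mathbf m|},\qquad \widetilde h_d=\lim_{m_1,\dots,m_d\to\infty}\frac{\log\#\widetilde W(\mathbf m)}{|\mathbf m|}.$$ **Transfer matrices.** For $n\in\mathbb N$ and $\mathbf m\in\mathbb N^n$ let $B(\mathbf m)$ and $\widetilde B(\mathbf m)$ be the symmetric matrices with rows and columns indexed by the subsets of $T(\mathbf m)$ whose $(S,R)$ entry is $0$ if $S\cap R\neq\emptyset$, and otherwise is the number of tilings of $U=T(\mathbf m)\setminus(S\cup R)$ by monomers and dimers of the torus (for $\widetilde B$: by dimers only) contained in $U$; this number is $1$ if $U=\emptyset$. Let $\beta(\mathbf m)$ and $\widetilde\beta(\mathbf m)$ be the spectral radii of $B(\mathbf m)$ and $\widetilde B(\mathbf m)$. In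 addition put $\beta(0)=\widetilde\beta(0)=2$ and $$\beta(n,0)=\beta(0,n)=\widetilde\beta(n,0)=\widetilde\beta(0,n)=2^n\qquad(n\in\mathbb N).$$ **Theorem.** The limits defining $h_2,\widetilde h_2,h_3,\widetilde h_3$ exist and are finite, and for all $p,r,t,u,v\in\mathbb N$ and $q,s\in\mathbb Z_+$, $$\frac{\log\beta(2r)}{2r}\ \ge\ h_2\ \ge\ \frac{\log\beta(p+2q)-\log\beta(2q)}{p},$$ $$\frac{\log\widetilde\beta(2r)}{2r}\ \ge\ \widetilde h_2\ \ge\ \frac{\log\widetilde\beta(p+2q)-\log\widetilde\beta(2q)}{p},$$ $$\frac{\log\beta(2r,2t)}{4rt}\ \ge\ h_3\ \ge\ \frac{\log\beta(p+2q,u+2s)-\log\beta(p+2q,2s)}{up}-\frac{\log\beta(2q,2v)}{2vp},$$ $$\frac{\log\widetilde\beta(2r,2t)}{4rt}\ \ge\ \widetilde h_3\ \ge\ \frac{\log\widetilde\beta(p+2q,u+2s)-\log\widetilde\beta(p+2q,2s)}{up}-\frac{\log\widetilde\beta(2q,2v)}{2vp}.$$ -/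

import Mathlib

open Filter Topology

/-- The points of the `d`-dimensional box with side lengths `m 0, …, m (d - 1)`.  The same points are
used for the torus with these side lengths. -/
abbrev Box {d : ℕ} (m : Fin d → ℕ) : Type := (k : Fin d) → Fin (m k)

/-- The `2 d + 1` colours encoding monomer-dimer covers in dimension `d`: two colours for each
direction, and one colour (`none`) for monomers. -/
abbrev Colour (d : ℕ) : Type := Option (Fin d ⊕ Fin d)

/-- The colour of the initial point `i` of a dimer occupying `i` and `i + e_k`. -/
abbrev Colour.head {d : ℕ} (k : Fin d) : Colour d := some (Sum.inl k)

/-- The colour of the final point `i + e_k` of a dimer occupying `i` and `i + e_k`. -/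
abbrev Colour.tail {d : ℕ} (k : Fin d) : Colour d := some (Sum.inr k)

/-- The colour of a monomer. -/
abbrev Colour.monomer {d : ℕ} : Colour d := none

/-- The nearest neighbour digraph in direction `k` of the encoding: the colours `a` and `b` may occupy
`i` and `i + e_k` iff either both or none of "`a` is the head of a dimer in direction `k`" and
"`b` is the tail of a dimer in direction `k`" hold. -/
def NeighbourRel {d : ℕ} (k : Fin d) (a b : Colour d) : Prop :=
  a = Colour.head k ↔ b = Colour.tail k

/-- `y = x + e_k` inside the box. -/
def IsStep {d : ℕ} {m : Fin d → ℕ} (k : Fin d) (x y : Box m) : Prop :=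
  (y k : ℕ) = x k + 1 ∧ ∀ j, j ≠ k → y j = x j

/-- The colourings of the box that encode monomer-dimer covers of the box: each monomer is in the box,
and each dimer meets the box (but may protrude out of it). -/
def monomerDimerCovers {d : ℕ} (m : Fin d → ℕ) : Set (Box m → Colour d) :=
  {φ | ∀ (k : Fin d) (x y : Box m), IsStep k x y → NeighbourRel k (φ x) (φ y)}

/-- The covers without monomers. -/
def dimerCovers {d : ℕ} (m : Fin d → ℕ) : Set (Box m → Colour d) :=
  {φ ∈ monomerDimerCovers m | ∀ x, φ x ≠ Colour.monomer}

/-- `log #W(m) / (m_1 ⋯ m_d)` for the set `W(m)` of monomer-dimer covers of the box. -/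
noncomputable def monomerDimerRate {d : ℕ} (m : Fin d → ℕ) : ℝ :=
  Real.log ((monomerDimerCovers m).ncard : ℝ) / ((∏ k, m k : ℕ) : ℝ)

/-- `log #W(m) / (m_1 ⋯ m_d)` for the set `W(m)` of dimer covers of the box. -/
noncomputable def dimerRate {d : ℕ} (m : Fin d → ℕ) : ℝ :=
  Real.log ((dimerCovers m).ncard : ℝ) / ((∏ k, m k : ℕ) : ℝ)

/-- The monomer-dimer entropy `h_d`: the limit as all the side lengths tend to infinity. -/
noncomputable def monomerDimerEntropy (d : ℕ) : ℝ :=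
  limUnder atTop (fun m : Fin d → ℕ => monomerDimerRate m)

/-- The dimer entropy `h̃_d`: the limit as all the side lengths tend to infinity. -/
noncomputable def dimerEntropy (d : ℕ) : ℝ :=
  limUnder atTop (fun m : Fin d → ℕ => dimerRate m)

/-- The point `x + e_k` of the torus (addition modulo `m k` in coordinate `k`). -/
def torusStep {n : ℕ} {m : Fin n → ℕ} (k : Fin n) (x : Box m) : Box m :=
  Function.update x k (finRotate (m k) (x k))

/-- The monomer-dimer tilings of a set `U` of points of the torus, encoded as colourings of `U`: the
other half of each half-dimer is at the right place of the torus, and lies in `U`.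

A dimer is determined by its direction `k` and its initial point `x`, and occupies `x` and `x + e_k`.
So it may wrap around; if `m k = 2` there are two different dimers in direction `k` on the points
`x`, `x + e_k`, and if `m k = 1` there are no dimers in direction `k`, as `x + e_k = x`. -/
def torusTilings {n : ℕ} {m : Fin n → ℕ} (U : Finset (Box m)) : Set (↥U → Colour n) :=
  {φ | ∀ (x : ↥U) (k : Fin n),
    (φ x = Colour.head k → ∃ y : ↥U, (y : Box m) = torusStep k x ∧ φ y = Colour.tail k) ∧
    (φ x = Colour.tail k → ∃ y : ↥U, (x : Box m) = torusStep k y ∧ φ y = Colour.head k)}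

/-- The tilings without monomers. -/
def torusDimerTilings {n : ℕ} {m : Fin n → ℕ} (U : Finset (Box m)) : Set (↥U → Colour n) :=
  {φ ∈ torusTilings U | ∀ x, φ x ≠ Colour.monomer}

/-- The transfer matrix `B(m)`, indexed by the sets of points of the torus. -/
noncomputable def transferMatrix {n : ℕ} (m : Fin n → ℕ) :
    Matrix (Finset (Box m)) (Finset (Box m)) ℕ :=
  Matrix.of fun S T => if S ∩ T = ∅ then (torusTilings (S ∪ T)ᶜ).ncard else 0

/-- The transfer matrix `B̃(m)` for dimer tilings. -/
noncomputable def dimerTransferMatrix {n : ℕ} (m : Fin n → ℕ) :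
    Matrix (Finset (Box m)) (Finset (Box m)) ℕ :=
  Matrix.of fun S T => if S ∩ T = ∅ then (torusDimerTilings (S ∪ T)ᶜ).ncard else 0

/-- The spectral radius of a square matrix of natural numbers: the largest modulus of its complex
eigenvalues. -/
noncomputable def matrixRadius {ι : Type*} [Fintype ι] [DecidableEq ι] (M : Matrix ι ι ℕ) : ℝ :=
  (spectralRadius ℂ (M.map (fun a : ℕ => (a : ℂ)))).toReal

/-- `β(m)`, with the convention `β(0) = 2`. -/
noncomputable def beta₁ (m : ℕ) : ℝ :=
  if m = 0 then 2 else matrixRadius (transferMatrix ![m])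

/-- `β̃(m)`, with the convention `β̃(0) = 2`. -/
noncomputable def dimerBeta₁ (m : ℕ) : ℝ :=
  if m = 0 then 2 else matrixRadius (dimerTransferMatrix ![m])

/-- `β(m, n)`, with the convention `β(m, 0) = 2 ^ m`, `β(0, n) = 2 ^ n`. -/
noncomputable def beta₂ (m n : ℕ) : ℝ :=
  if n = 0 then 2 ^ m else if m = 0 then 2 ^ n else matrixRadius (transferMatrix ![m, n])

/-- `β̃(m, n)`, with the convention `β̃(m, 0) = 2 ^ m`, `β̃(0, n) = 2 ^ n`. -/
noncomputable def dimerBeta₂ (m n : ℕ) : ℝ :=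
  if n = 0 then 2 ^ m else if m = 0 then 2 ^ n else matrixRadius (dimerTransferMatrix ![m, n])

/-! Cut a box or torus into slices orthogonal to one direction. A cover becomes a chain of slice
colourings in which the dimers leaving a slice are those entering the next, so covers are counted by
a power of a slice matrix M: by its trace if the direction is periodic, by the sum of its entries if
it is open (`ncard_periodicCovers_eq_trace`, `ncard_periodicCovers_eq_sum`). For a torus slice, M is
B or B̃ (`sliceMatrix_torus_apply`). A proposition `D` selects covers with or without monomers, so
one argument serves both.

Reflection makes M symmetric. If M has N rows and spectral radius ρ, then ρ^n ≤ tr M^n ≤ N ρ^n and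
tr M^(p+n) ≤ ρ^p tr M^n for even n, while the entries of M^n sum to at most N^3 ρ^n. Here N =
2^(size of the slice), so powers of N vanish in the limit.

Existence: log #W is subadditive in each side length, and the limit is the infimum of the rates.

Upper bounds: the slice matrix orthogonal to a direction is the same whether that direction is open
or periodic. Comparing both counts with ρ, an open direction can be replaced by one of any even
period at a vanishing cost (`periodicRate_le_periodicRate`). Do so in all directions but one, and
transfer along the last.

Lower bounds: counting the covers of one torus along two directions exchanges a side length with the
exponent. For even x, β(p+2q)^x ≤ tr B(p+2q)^x = tr B(x)^(p+2q) ≤ β(x)^p tr B(x)^(2q), where tr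
B(x)^(2q) ≤ 2^(2q) β(2q)^x and β(x)^x ≤ #W(x,x). Take logarithms, divide by x and let x tend to
infinity. Dimension three repeats this along two directions (`logBeta₂_lower_bound`). The values of
β at 0 are those making the trace estimate hold for the exponent 0. -/

/-! ### Symmetric matrices of natural numbers -/

section SymmetricMatrix

variable {ι : Type*} [Fintype ι] [DecidableEq ι]

theorem Matrix.IsHermitian.trace_pow_eq_sum_eigenvalues {A : Matrix ι ι ℂ} (hA : A.IsHermitian)
    (n : ℕ) : (A ^ n).trace = ∑ i, (hA.eigenvalues i : ℂ) ^ n := by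
  conv_lhs => rw [hA.spectral_theorem]
  rw [← map_pow, Matrix.diagonal_pow, Unitary.conjStarAlgAut_apply, Matrix.trace_mul_comm,
    ← mul_assoc]
  simp [Matrix.trace_diagonal]

theorem Matrix.IsHermitian.toReal_spectralRadius_eq {A : Matrix ι ι ℂ} (hA : A.IsHermitian) :
    (spectralRadius ℂ A).toReal = ⨆ i, |hA.eigenvalues i| := by
  have h : spectralRadius ℂ A = ⨆ i, (‖hA.eigenvalues i‖₊ : ENNReal) := by
    rw [spectralRadius, hA.spectrum_eq_image_range, iSup_image, iSup_range]
    simp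
  rw [h, ENNReal.toReal_iSup (by simp)]
  simp

/-- The eigenvalues of a symmetric matrix of natural numbers. -/
theorem exists_eigenvalues {M : Matrix ι ι ℕ} (hM : M.IsSymm) :
    ∃ ev : ι → ℝ, (∀ n, ((M ^ n).trace : ℝ) = ∑ i, ev i ^ n) ∧ (∀ i, |ev i| ≤ matrixRadius M) ∧
      (Nonempty ι → ∃ i, matrixRadius M = |ev i|) := by
  have hH : (M.map (fun a : ℕ => (a : ℂ))).IsHermitian := by
    ext i j
    simp [hM.apply i j]
  have hr : matrixRadius M = ⨆ i, |hH.eigenvalues i| := hH.toReal_spectralRadius_eq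
  refine ⟨hH.eigenvalues, fun n => ?_, fun i => ?_, fun _ => ?_⟩
  · have h := hH.trace_pow_eq_sum_eigenvalues n
    have h2 : (M.map (fun a : ℕ => (a : ℂ))) ^ n = (M ^ n).map (Nat.castRingHom ℂ) := by
      rw [Matrix.map_pow]; rfl
    rw [h2, ← AddMonoidHom.map_trace (Nat.castRingHom ℂ)] at h
    have h3 : (((M ^ n).trace : ℝ) : ℂ) = ((∑ i, hH.eigenvalues i ^ n : ℝ) : ℂ) := by
      push_cast
      exact h
    exact_mod_cast h3
  · rw [hr]
    exact le_ciSup (f := fun i => |hH.eigenvalues i|) (Set.finite_range _).bddAbove i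
  · obtain ⟨i, hi⟩ := exists_eq_ciSup_of_finite (f := fun i => |hH.eigenvalues i|)
    exact ⟨i, by rw [hr, ← hi]⟩

theorem matrixRadius_nonneg (M : Matrix ι ι ℕ) : 0 ≤ matrixRadius M := ENNReal.toReal_nonneg

/-- Even powers of the real eigenvalues are nonnegative, so the trace dominates the term of an
eigenvalue of largest modulus. -/
theorem matrixRadius_pow_le_trace [Nonempty ι] {M : Matrix ι ι ℕ} (hM : M.IsSymm) {n : ℕ}
    (hn : Even n) : matrixRadius M ^ n ≤ ((M ^ n).trace : ℝ) := by
  obtain ⟨ev, h1, -, h3⟩ := exists_eigenvalues hM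
  obtain ⟨i, hi⟩ := h3 inferInstance
  rw [h1, hi, hn.pow_abs]
  exact Finset.single_le_sum (f := fun i => ev i ^ n) (fun j _ => hn.pow_nonneg _)
    (Finset.mem_univ i)

/-- Evenness of n is what matters: the weights λ^n are nonnegative, so each factor λ^p may be
replaced by ρ^p, whatever the parity of p. -/
theorem trace_pow_add_le {M : Matrix ι ι ℕ} (hM : M.IsSymm) (p : ℕ) {n : ℕ} (hn : Even n) :
    ((M ^ (p + n)).trace : ℝ) ≤ matrixRadius M ^ p * ((M ^ n).trace : ℝ) := by
  obtain ⟨ev, h1, h2, -⟩ := exists_eigenvalues hM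
  rw [h1, h1, Finset.mul_sum]
  refine Finset.sum_le_sum fun i _ => ?_
  rw [pow_add]
  refine mul_le_mul_of_nonneg_right ?_ (hn.pow_nonneg _)
  calc ev i ^ p ≤ |ev i ^ p| := le_abs_self _
    _ = |ev i| ^ p := abs_pow _ _
    _ ≤ _ := pow_le_pow_left₀ (abs_nonneg _) (h2 i) p

theorem trace_pow_le {M : Matrix ι ι ℕ} (hM : M.IsSymm) (n : ℕ) :
    ((M ^ n).trace : ℝ) ≤ Fintype.card ι * matrixRadius M ^ n := by
  have h := trace_pow_add_le hM n (n := 0) (by simp)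
  simpa [Matrix.trace_one, mul_comm] using h

/-- By symmetry tr M^(2n) is the sum of the squares of the entries of M^n. -/
theorem entry_pow_le {M : Matrix ι ι ℕ} (hM : M.IsSymm) (n : ℕ) (i j : ι) :
    ((M ^ n) i j : ℝ) ≤ Fintype.card ι * matrixRadius M ^ n := by
  have hs : (M ^ n).IsSymm := hM.pow n
  have h1 : (M ^ n) i j ^ 2 ≤ (M ^ (n + n)).trace := by
    rw [pow_add, Matrix.trace]
    calc (M ^ n) i j ^ 2 = (M ^ n) i j * (M ^ n) j i := by rw [hs.apply i j, sq]
      _ ≤ ∑ k, (M ^ n) i k * (M ^ n) k i :=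
        Finset.single_le_sum (f := fun k => (M ^ n) i k * (M ^ n) k i)
          (fun _ _ => Nat.zero_le _) (Finset.mem_univ j)
      _ ≤ _ := Finset.single_le_sum (f := fun l => ∑ k, (M ^ n) l k * (M ^ n) k l)
          (fun _ _ => Nat.zero_le _) (Finset.mem_univ i)
  have h2 := trace_pow_le hM (n + n)
  have h3 : (((M ^ n) i j : ℕ) : ℝ) ^ 2 ≤ Fintype.card ι * matrixRadius M ^ (n + n) :=
    le_trans (by exact_mod_cast h1) h2
  have hc : (1 : ℝ) ≤ Fintype.card ι := by
    exact_mod_cast Fintype.card_pos_iff.2 ⟨i⟩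
  have hp : 0 ≤ matrixRadius M ^ n := pow_nonneg (matrixRadius_nonneg M) n
  refine le_of_sq_le_sq ?_ (by positivity)
  calc _ ≤ _ := h3
    _ ≤ _ := by
      rw [pow_add, mul_pow, ← sq, sq (Fintype.card ι : ℝ)]
      exact mul_le_mul_of_nonneg_right (le_mul_of_one_le_left (by positivity) hc) (by positivity)

theorem sum_entries_pow_le {M : Matrix ι ι ℕ} (hM : M.IsSymm) (n : ℕ) :
    ((∑ i, ∑ j, (M ^ n) i j : ℕ) : ℝ) ≤ (Fintype.card ι : ℝ) ^ 3 * matrixRadius M ^ n := by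
  push_cast
  calc _ ≤ ∑ _i : ι, ∑ _j : ι, (Fintype.card ι * matrixRadius M ^ n : ℝ) :=
        Finset.sum_le_sum fun i _ => Finset.sum_le_sum fun j _ => entry_pow_le hM n i j
    _ = _ := by simp; ring

end SymmetricMatrix

/-! ### Counting chains by powers of a matrix -/

section Chains

variable {Ψ ι : Type*}

/-- The number of states with given left and right types. -/
noncomputable def stateMatrix (l r : Ψ → ι) : Matrix ι ι ℕ :=
  Matrix.of fun S R => Nat.card {ψ : Ψ // l ψ = S ∧ r ψ = R}

theorem stateMatrix_apply (l r : Ψ → ι) (S R : ι) :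
    stateMatrix l r S R = Nat.card {ψ : Ψ // l ψ = S ∧ r ψ = R} := rfl

variable [Finite Ψ] [Fintype ι] [DecidableEq ι]

theorem card_chains_between (l r : Ψ → ι) (n : ℕ) (S R : ι) :
    Nat.card {f : Fin (n + 1) → Ψ // (∀ i j : Fin (n + 1), (j : ℕ) = i + 1 → r (f i) = l (f j)) ∧
      l (f 0) = S ∧ r (f (Fin.last n)) = R} = (stateMatrix l r ^ (n + 1)) S R := by
  induction n generalizing S with
  | zero =>
    rw [show stateMatrix l r ^ (0 + 1) = stateMatrix l r from pow_one _, stateMatrix_apply]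
    refine Nat.card_congr ((Equiv.funUnique (Fin 1) Ψ).subtypeEquiv fun f => ?_)
    simp only [Equiv.funUnique_apply]
    constructor
    · rintro ⟨-, h1, h2⟩
      exact ⟨h1, h2⟩
    · rintro ⟨h1, h2⟩
      exact ⟨fun i j h => by omega, h1, h2⟩
  | succ n ih =>
    -- Split off the first state; the summation index of the matrix product is its right type.
    rw [pow_succ', Matrix.mul_apply]
    simp only [stateMatrix_apply, ← ih, ← Nat.card_prod]
    rw [← Nat.card_sigma]
    refine Nat.card_congr
      { toFun := fun f => ⟨r (f.1 0), ⟨f.1 0, f.2.2.1, rfl⟩, ⟨Fin.tail f.1, ?_, ?_, ?_⟩⟩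
        invFun := fun g => ⟨Fin.cons g.2.1.1 g.2.2.1, ?_, ?_, ?_⟩
        left_inv := ?_
        right_inv := ?_ }
    · intro i j h
      exact f.2.1 i.succ j.succ (by simp [h])
    · exact (f.2.1 0 (Fin.succ 0) (by simp)).symm
    · exact f.2.2.2
    · intro i j h
      obtain ⟨T, ⟨ψ, h1, h2⟩, g, h3, h4, h5⟩ := g
      obtain ⟨j, rfl⟩ := Fin.exists_succ_eq.2 (show j ≠ 0 by rintro rfl; simp at h)
      cases i using Fin.cases with
      | zero =>
        have : j = 0 := by ext; simpa using h
        subst this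
        simp [h2, h4]
      | succ i =>
        simpa using h3 i j (by simpa using h)
    · simpa using g.2.1.2.1
    · rw [← Fin.succ_last, Fin.cons_succ]
      exact g.2.2.2.2.2
    · intro f
      simp
    · rintro ⟨T, ⟨ψ, h1, rfl⟩, g, h3, h4, h5⟩
      simp
      rfl

theorem card_open_chains (l r : Ψ → ι) {n : ℕ} (hn : n ≠ 0) :
    Nat.card {f : Fin n → Ψ // ∀ i j : Fin n, (j : ℕ) = i + 1 → r (f i) = l (f j)} =
      ∑ S, ∑ R, (stateMatrix l r ^ n) S R := by
  obtain ⟨n, rfl⟩ := Nat.exists_eq_succ_of_ne_zero hn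
  simp only [Nat.succ_eq_add_one, ← card_chains_between, ← Nat.card_sigma]
  refine Nat.card_congr
    { toFun := fun f => ⟨l (f.1 0), r (f.1 (Fin.last n)), f.1, f.2, rfl, rfl⟩
      invFun := fun g => ⟨g.2.2.1, g.2.2.2.1⟩
      left_inv := fun f => rfl
      right_inv := ?_ }
  rintro ⟨S, R, f, h1, rfl, rfl⟩
  rfl

theorem card_closed_chains (l r : Ψ → ι) {n : ℕ} (hn : n ≠ 0) :
    Nat.card {f : Fin n → Ψ // ∀ i j : Fin n, j = finRotate n i → r (f i) = l (f j)} =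
      (stateMatrix l r ^ n).trace := by
  obtain ⟨n, rfl⟩ := Nat.exists_eq_succ_of_ne_zero hn
  simp only [Nat.succ_eq_add_one, Matrix.trace, Matrix.diag_apply, ← card_chains_between,
    ← Nat.card_sigma]
  refine Nat.card_congr
    { toFun := fun f => ⟨l (f.1 0), f.1, fun i j h => f.2 i j ?_, rfl, f.2 _ _ (by simp)⟩
      invFun := fun g => ⟨g.2.1, ?_⟩
      left_inv := fun f => rfl
      right_inv := ?_ }
  · have : i ≠ Fin.last n := fun hi => by
      have := j.2
      rw [hi] at h
      simp at h
      omega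
    ext
    rw [coe_finRotate_of_ne_last this, h]
  · rintro i j rfl
    obtain ⟨S, f, h1, h2, h3⟩ := g
    by_cases hi : i = Fin.last n
    · subst hi
      simp [h2, h3]
    · exact h1 i _ (coe_finRotate_of_ne_last hi)
  · rintro ⟨S, f, h1, rfl, h3⟩
    rfl

end Chains

/-! ### Covers of products of paths and cycles -/

/-- `j = i + 1` in the cycle (`true`) or in the path (`false`) with `n` points. -/
def StepRel : Bool → {n : ℕ} → Fin n → Fin n → Prop
  -- In a cycle of one point, the point is its own successor, and `NeighbourRel` then excludes both
  -- halves of a dimer in that direction, as required on the torus.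
  | true, n, i, j => j = finRotate n i
  | false, _, i, j => (j : ℕ) = i + 1

/-- `y = x + e_k`, where the directions with `per k = true` are periodic. -/
def PeriodicStep {d : ℕ} (per : Fin d → Bool) {m : Fin d → ℕ} (k : Fin d) (x y : Box m) : Prop :=
  StepRel (per k) (x k) (y k) ∧ ∀ j, j ≠ k → y j = x j

/-- The covers of the box that are periodic in the directions with `per k = true`, while the dimers
may protrude in the other directions.  If `D` holds, then there are no monomers. -/
def periodicCovers (D : Prop) {d : ℕ} (per : Fin d → Bool) (m : Fin d → ℕ) :
    Set (Box m → Colour d) :=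
  {φ | (∀ (k : Fin d) (x y : Box m), PeriodicStep per k x y → NeighbourRel k (φ x) (φ y)) ∧
    (D → ∀ x, φ x ≠ Colour.monomer)}

theorem monomerDimerCovers_eq {d : ℕ} (m : Fin d → ℕ) :
    monomerDimerCovers m = periodicCovers False (fun _ => false) m := by
  ext φ
  exact ⟨fun h => ⟨h, False.elim⟩, fun h => h.1⟩

theorem dimerCovers_eq {d : ℕ} (m : Fin d → ℕ) :
    dimerCovers m = periodicCovers True (fun _ => false) m := by
  ext φ
  exact ⟨fun h => ⟨h.1, fun _ => h.2⟩, fun h => ⟨h.1, h.2 trivial⟩⟩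

theorem StepRel.of_le {b c : Bool} (h : b ≤ c) {n : ℕ} {i j : Fin n} (hij : StepRel b i j) :
    StepRel c i j := by
  cases b <;> cases c
  · exact hij
  · obtain _ | n := n
    · exact i.elim0
    · have hij : (j : ℕ) = i + 1 := hij
      have hi : i ≠ Fin.last n := by
        rintro rfl
        have := j.2
        simp at hij
        omega
      show j = finRotate (n + 1) i
      ext
      rw [coe_finRotate_of_ne_last hi, hij]
  · exact absurd h (by decide)
  · exact hij

/-- Every step of a path is a step of the cycle, so periodicity only adds constraints. This is how
torus counts bound #W from below. -/
theorem periodicCovers_anti (D : Prop) {d : ℕ} {per per' : Fin d → Bool} (h : per ≤ per')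
    (m : Fin d → ℕ) : periodicCovers D per' m ⊆ periodicCovers D per m :=
  fun _ hφ => ⟨fun k x y hxy => hφ.1 k x y ⟨hxy.1.of_le (h k), hxy.2⟩, hφ.2⟩

/-- The colours of the points of a slice orthogonal to a direction, which is denoted by `none`. -/
abbrev SliceColour (d : ℕ) : Type := Option (Option (Fin d) ⊕ Option (Fin d))

/-- The colourings of a slice that may occur in a cover. -/
abbrev SliceColouring (D : Prop) {d : ℕ} (per : Fin d → Bool) (m : Fin d → ℕ) : Type :=
  {ψ : Box m → SliceColour d //
    (∀ (k : Fin d) (x y : Box m), PeriodicStep per k x y →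
      (ψ x = some (Sum.inl (some k)) ↔ ψ y = some (Sum.inr (some k)))) ∧ (D → ∀ x, ψ x ≠ none)}

namespace SliceColouring

variable {D : Prop} {d : ℕ} {per : Fin d → Bool} {m : Fin d → ℕ}

/-- The points occupied by dimers that begin in the previous slice. -/
noncomputable def left (ψ : SliceColouring D per m) : Finset (Box m) :=
  Finset.univ.filter fun x => ψ.1 x = some (Sum.inr none)

/-- The points occupied by dimers that end in the next slice. -/
noncomputable def right (ψ : SliceColouring D per m) : Finset (Box m) :=
  Finset.univ.filter fun x => ψ.1 x = some (Sum.inl none)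

@[simp] theorem mem_left {ψ : SliceColouring D per m} {x : Box m} :
    x ∈ ψ.left ↔ ψ.1 x = some (Sum.inr none) := by
  simp [left]

@[simp] theorem mem_right {ψ : SliceColouring D per m} {x : Box m} :
    x ∈ ψ.right ↔ ψ.1 x = some (Sum.inl none) := by
  simp [right]

/-- Exchange the two ends of the dimers orthogonal to the slice. -/
def reflect (ψ : SliceColouring D per m) : SliceColouring D per m :=
  ⟨fun x => Equiv.swap (some (Sum.inl none)) (some (Sum.inr none)) (ψ.1 x),
    fun k x y h => by
      simp only [Equiv.swap_apply_eq_iff]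
      rw [Equiv.swap_apply_of_ne_of_ne (by simp) (by simp),
        Equiv.swap_apply_of_ne_of_ne (by simp) (by simp)]
      exact ψ.2.1 k x y h,
    fun hD x => by
      rw [Ne, Equiv.swap_apply_eq_iff, Equiv.swap_apply_of_ne_of_ne (by simp) (by simp)]
      exact ψ.2.2 hD x⟩

@[simp] theorem reflect_reflect (ψ : SliceColouring D per m) : ψ.reflect.reflect = ψ := by
  ext1
  funext x
  exact Equiv.swap_apply_self _ _ _

@[simp] theorem left_reflect (ψ : SliceColouring D per m) : ψ.reflect.left = ψ.right := by
  ext x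
  rw [mem_left, mem_right]
  simp only [reflect, Equiv.swap_apply_eq_iff, Equiv.swap_apply_right]

@[simp] theorem right_reflect (ψ : SliceColouring D per m) : ψ.reflect.right = ψ.left := by
  rw [← left_reflect, reflect_reflect]

end SliceColouring

/-- The transfer matrix of a slice that is periodic in the directions with `per k = true`. -/
noncomputable def sliceMatrix (D : Prop) {d : ℕ} (per : Fin d → Bool) (m : Fin d → ℕ) :
    Matrix (Finset (Box m)) (Finset (Box m)) ℕ :=
  stateMatrix (SliceColouring.left (D := D) (per := per)) SliceColouring.right

/-- Reflecting a slice in its own hyperplane exchanges incoming and outgoing dimers and leaves the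
rest alone. -/
theorem sliceMatrix_isSymm (D : Prop) {d : ℕ} (per : Fin d → Bool) (m : Fin d → ℕ) :
    (sliceMatrix D per m).IsSymm := by
  ext S R
  rw [Matrix.transpose_apply, sliceMatrix, stateMatrix_apply, stateMatrix_apply]
  exact Nat.card_congr
    { toFun := fun ψ => ⟨ψ.1.reflect, by simp [ψ.2]⟩
      invFun := fun ψ => ⟨ψ.1.reflect, by simp [ψ.2]⟩
      left_inv := fun ψ => by simp
      right_inv := fun ψ => by simp }

/-! ### Cutting covers into chains of slices -/

section Slicing

variable {d : ℕ} (m : Fin (d + 1) → ℕ) (k : Fin (d + 1))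

/-- Name the directions relative to the slices orthogonal to direction `k`. -/
def sliceColourEquiv : Colour (d + 1) ≃ SliceColour d :=
  Equiv.optionCongr (Equiv.sumCongr (finSuccEquiv' k) (finSuccEquiv' k))

/-- Cut a colouring into slices orthogonal to direction `k`. -/
def sliceEquiv : (Box m → Colour (d + 1)) ≃
    (Fin (m k) → Box (fun j => m (k.succAbove j)) → SliceColour d) :=
  (Equiv.arrowCongr (Fin.insertNthEquiv (fun j => Fin (m j)) k).symm
    (sliceColourEquiv k)).trans (Equiv.curry _ _ _)

theorem sliceEquiv_apply (φ : Box m → Colour (d + 1)) (i : Fin (m k))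
    (x : Box fun j => m (k.succAbove j)) :
    sliceEquiv m k φ i x =
      sliceColourEquiv k (φ (Fin.insertNth (α := fun j => Fin (m j)) k i x)) := rfl

theorem periodicStep_insertNth_self (per : Fin (d + 1) → Bool) (i j : Fin (m k))
    (x y : Box fun j => m (k.succAbove j)) :
    PeriodicStep per k (Fin.insertNth (α := fun j => Fin (m j)) k i x : Box m)
      (Fin.insertNth (α := fun j => Fin (m j)) k j y : Box m) ↔ StepRel (per k) i j ∧ y = x := by
  rw [PeriodicStep, Fin.insertNth_apply_same, Fin.insertNth_apply_same]
  refine and_congr_right fun _ => ⟨fun h => ?_, ?_⟩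
  · ext1 q
    simpa using h (k.succAbove q) (Fin.succAbove_ne k q)
  · rintro rfl q hq
    obtain ⟨q, rfl⟩ := Fin.exists_succAbove_eq hq
    simp

theorem periodicStep_insertNth_succAbove (per : Fin (d + 1) → Bool) (q : Fin d) (i j : Fin (m k))
    (x y : Box fun j => m (k.succAbove j)) :
    PeriodicStep per (k.succAbove q) (Fin.insertNth (α := fun j => Fin (m j)) k i x : Box m)
      (Fin.insertNth (α := fun j => Fin (m j)) k j y : Box m) ↔
      PeriodicStep (fun j => per (k.succAbove j)) q x y ∧ i = j := by
  simp only [PeriodicStep, Fin.insertNth_apply_succAbove, Fin.forall_iff_succAbove k,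
    Fin.insertNth_apply_same]
  simp only [ne_eq, Fin.succAbove_right_inj]
  have : k ≠ k.succAbove q := (Fin.succAbove_ne k q).symm
  simp only [this, not_false_eq_true, forall_const]
  tauto

/-- Steps along the slices constrain each slice separately; steps in direction `k` only link the
outgoing dimers of a slice to the incoming ones of its successor. -/
theorem mem_periodicCovers_iff (D : Prop) (per : Fin (d + 1) → Bool) (φ : Box m → Colour (d + 1)) :
    φ ∈ periodicCovers D per m ↔
      (∀ i, (∀ (q : Fin d) x y, PeriodicStep (fun j => per (k.succAbove j)) q x y →
        (sliceEquiv m k φ i x = some (Sum.inl (some q)) ↔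
          sliceEquiv m k φ i y = some (Sum.inr (some q)))) ∧
          (D → ∀ x, sliceEquiv m k φ i x ≠ none)) ∧
      ∀ i j, StepRel (per k) i j → ∀ x,
        (sliceEquiv m k φ i x = some (Sum.inl none) ↔
          sliceEquiv m k φ j x = some (Sum.inr none)) := by
  have e {a c : Colour (d + 1)} {b : SliceColour d} (h : sliceColourEquiv k a = b) :
      sliceColourEquiv k c = b ↔ c = a := by
    rw [← h]; exact (sliceColourEquiv k).apply_eq_iff_eq
  have e1 (q : Fin d) (c : Colour (d + 1)) : sliceColourEquiv k c = some (Sum.inl (some q)) ↔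
      c = Colour.head (k.succAbove q) :=
    e (by simp [sliceColourEquiv])
  have e2 (q : Fin d) (c : Colour (d + 1)) : sliceColourEquiv k c = some (Sum.inr (some q)) ↔
      c = Colour.tail (k.succAbove q) :=
    e (by simp [sliceColourEquiv])
  have e3 (c : Colour (d + 1)) : sliceColourEquiv k c = some (Sum.inl none) ↔
      c = Colour.head k :=
    e (by simp [sliceColourEquiv])
  have e4 (c : Colour (d + 1)) : sliceColourEquiv k c = some (Sum.inr none) ↔
      c = Colour.tail k :=
    e (by simp [sliceColourEquiv])
  have e5 (c : Colour (d + 1)) : sliceColourEquiv k c = none ↔ c = Colour.monomer :=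
    e (by simp [sliceColourEquiv])
  simp only [sliceEquiv_apply, ne_eq, e1, e2, e3, e4, e5]
  have hall (P : Box m → Prop) : (∀ x, P x) ↔
      ∀ i x, P (Fin.insertNth (α := fun j => Fin (m j)) k i x) :=
    ((Fin.insertNthEquiv (fun j => Fin (m j)) k).forall_congr_right (q := P)).symm.trans
      Prod.forall
  constructor
  · rintro ⟨h1, h2⟩
    refine ⟨fun i => ⟨fun q x y hxy => ?_, fun hD x => h2 hD _⟩, fun i j hij x => ?_⟩
    · exact h1 _ _ _ ((periodicStep_insertNth_succAbove m k per q i i x y).2 ⟨hxy, rfl⟩)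
    · exact h1 _ _ _ ((periodicStep_insertNth_self m k per i j x x).2 ⟨hij, rfl⟩)
  · rintro ⟨h1, h2⟩
    refine ⟨fun q => ?_, fun hD => (hall _).2 fun i x => (h1 i).2 hD x⟩
    refine (hall _).2 fun i x => (hall _).2 fun j y hxy => ?_
    obtain rfl | ⟨q, rfl⟩ := Fin.eq_self_or_eq_succAbove k q
    · obtain ⟨hij, rfl⟩ := (periodicStep_insertNth_self m q per i j x y).1 hxy
      exact h2 i j hij y
    · obtain ⟨h, rfl⟩ := (periodicStep_insertNth_succAbove m k per q i j x y).1 hxy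
      exact (h1 i).1 q x y h

theorem ncard_periodicCovers_eq_card_chains (D : Prop) (per : Fin (d + 1) → Bool) :
    (periodicCovers D per m).ncard =
      Nat.card {f : Fin (m k) →
          SliceColouring D (fun j => per (k.succAbove j)) (fun j => m (k.succAbove j)) //
        ∀ i j, StepRel (per k) i j → (f i).right = (f j).left} := by
  rw [← Nat.card_coe_set_eq]
  refine Nat.card_congr
    { toFun := fun φ => ⟨fun i => ⟨sliceEquiv m k φ.1 i,
          ((mem_periodicCovers_iff m k D per φ.1).1 φ.2).1 i⟩, fun i j hij => ?_⟩
      invFun := fun f => ⟨(sliceEquiv m k).symm fun i => (f.1 i).1,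
        (mem_periodicCovers_iff m k D per _).2 ?_⟩
      left_inv := fun φ => by simp
      right_inv := fun f => by ext; simp }
  · ext x
    simpa using ((mem_periodicCovers_iff m k D per φ.1).1 φ.2).2 i j hij x
  · rw [Equiv.apply_symm_apply]
    refine ⟨fun i => (f.1 i).2, fun i j hij x => ?_⟩
    simpa using Finset.ext_iff.1 (f.2 i j hij) x

end Slicing

/-- Transfer along a direction that is not periodic. -/
theorem ncard_periodicCovers_eq_sum (D : Prop) {d : ℕ} {per : Fin (d + 1) → Bool}
    {m : Fin (d + 1) → ℕ} (k : Fin (d + 1)) (hk : per k = false) (hm : m k ≠ 0)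
    {per' : Fin d → Bool} {m' : Fin d → ℕ} (hper' : ∀ j, per (k.succAbove j) = per' j)
    (hm' : ∀ j, m (k.succAbove j) = m' j) :
    (periodicCovers D per m).ncard = ∑ S, ∑ R, (sliceMatrix D per' m' ^ m k) S R := by
  obtain rfl : (fun j => per (k.succAbove j)) = per' := funext hper'
  obtain rfl : (fun j => m (k.succAbove j)) = m' := funext hm'
  rw [ncard_periodicCovers_eq_card_chains m k, sliceMatrix, ← card_open_chains _ _ hm, hk]
  rfl

/-- Transfer along a periodic direction. -/
theorem ncard_periodicCovers_eq_trace (D : Prop) {d : ℕ} {per : Fin (d + 1) → Bool}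
    {m : Fin (d + 1) → ℕ} (k : Fin (d + 1)) (hk : per k = true) (hm : m k ≠ 0)
    {per' : Fin d → Bool} {m' : Fin d → ℕ} (hper' : ∀ j, per (k.succAbove j) = per' j)
    (hm' : ∀ j, m (k.succAbove j) = m' j) :
    (periodicCovers D per m).ncard = (sliceMatrix D per' m' ^ m k).trace := by
  obtain rfl : (fun j => per (k.succAbove j)) = per' := funext hper'
  obtain rfl : (fun j => m (k.succAbove j)) = m' := funext hm'
  rw [ncard_periodicCovers_eq_card_chains m k, sliceMatrix, ← card_closed_chains _ _ hm, hk]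
  rfl

/-! ### The transfer matrices of the torus -/

theorem torusStep_injective {n : ℕ} {m : Fin n → ℕ} (k : Fin n) :
    Function.Injective (torusStep k : Box m → Box m) := by
  intro x y h
  ext1 j
  have hj := congrFun h j
  by_cases hjk : j = k
  · subst hjk
    simpa [torusStep] using hj
  · simpa [torusStep, hjk] using hj

theorem torusStep_surjective {n : ℕ} {m : Fin n → ℕ} (k : Fin n) :
    Function.Surjective (torusStep k : Box m → Box m) :=
  Finite.injective_iff_surjective.1 (torusStep_injective k)

theorem periodicStep_torus_iff {n : ℕ} {m : Fin n → ℕ} {k : Fin n} {x y : Box m} :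
    PeriodicStep (fun _ => true) k x y ↔ y = torusStep k x := by
  rw [torusStep, Function.eq_update_iff]
  rfl

/-- The slice colour of a colour in the slice. -/
def Colour.toSlice {n : ℕ} : Colour n → SliceColour n :=
  Option.map (Sum.map some some)

/-- The colour in the slice of a slice colour. -/
def SliceColour.toColour {n : ℕ} : SliceColour n → Colour n
  | some (Sum.inl (some k)) => Colour.head k
  | some (Sum.inr (some k)) => Colour.tail k
  | _ => Colour.monomer

theorem Colour.toSlice_injective {n : ℕ} : Function.Injective (Colour.toSlice (n := n)) :=
  Option.map_injective (Sum.map_injective.2 ⟨Option.some_injective _, Option.some_injective _⟩)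

theorem SliceColour.toSlice_toColour {n : ℕ} {c : SliceColour n} (h : c ≠ some (Sum.inl none))
    (h' : c ≠ some (Sum.inr none)) : Colour.toSlice (SliceColour.toColour c) = c := by
  rcases c with _ | (_ | _) | (_ | _) <;> first | rfl | contradiction

theorem Colour.toSlice_eq_inl {n : ℕ} {c : Colour n} {k : Option (Fin n)} :
    c.toSlice = some (Sum.inl k) ↔ ∃ j, k = some j ∧ c = Colour.head j := by
  rcases c with _ | _ | _ <;> simp [Colour.toSlice, eq_comm]

theorem Colour.toSlice_eq_inr {n : ℕ} {c : Colour n} {k : Option (Fin n)} :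
    c.toSlice = some (Sum.inr k) ↔ ∃ j, k = some j ∧ c = Colour.tail j := by
  rcases c with _ | _ | _ <;> simp [Colour.toSlice, eq_comm]

theorem Colour.toSlice_eq_none {n : ℕ} {c : Colour n} :
    c.toSlice = none ↔ c = Colour.monomer := by
  simp [Colour.toSlice]

section Extend

variable {n : ℕ} {m : Fin n → ℕ} {S T : Finset (Box m)}

/-- Extend a colouring of the complement of `S ∪ T` to a slice: at `S`, dimers from the previous
slice end, and at `T`, dimers to the next slice begin. -/
noncomputable def extendTiling (φ : ↥(S ∪ T)ᶜ → Colour n) (x : Box m) : SliceColour n :=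
  if hS : x ∈ S then some (Sum.inr none) else if hT : x ∈ T then some (Sum.inl none) else
    Colour.toSlice (φ ⟨x, by simp [hS, hT]⟩)

theorem extendTiling_of_mem_left {φ : ↥(S ∪ T)ᶜ → Colour n} {x : Box m} (hx : x ∈ S) :
    extendTiling φ x = some (Sum.inr none) := by
  simp [extendTiling, hx]

theorem extendTiling_of_mem_right (h : S ∩ T = ∅) {φ : ↥(S ∪ T)ᶜ → Colour n} {x : Box m}
    (hx : x ∈ T) : extendTiling φ x = some (Sum.inl none) := by
  have : x ∉ S := fun hS => by
    have : x ∈ S ∩ T := Finset.mem_inter.2 ⟨hS, hx⟩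
    simp [h] at this
  simp [extendTiling, this, hx]

theorem extendTiling_coe (φ : ↥(S ∪ T)ᶜ → Colour n) (x : ↥(S ∪ T)ᶜ) :
    extendTiling φ x = Colour.toSlice (φ x) := by
  have hx := x.2
  simp only [Finset.mem_compl, Finset.mem_union, not_or] at hx
  simp [extendTiling, hx]

theorem extendTiling_eq_tail_iff {φ : ↥(S ∪ T)ᶜ → Colour n} {x : Box m} :
    extendTiling φ x = some (Sum.inr none) ↔ x ∈ S := by
  refine ⟨fun h => ?_, extendTiling_of_mem_left⟩
  by_contra hS
  by_cases hT : x ∈ T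
  · simp [extendTiling, hS, hT] at h
  · simp [extendTiling, hS, hT, Colour.toSlice_eq_inr] at h

theorem extendTiling_eq_head_iff (h : S ∩ T = ∅) {φ : ↥(S ∪ T)ᶜ → Colour n} {x : Box m} :
    extendTiling φ x = some (Sum.inl none) ↔ x ∈ T := by
  refine ⟨fun hx => ?_, extendTiling_of_mem_right h⟩
  by_contra hT
  by_cases hS : x ∈ S
  · simp [extendTiling, hS] at hx
  · simp [extendTiling, hS, hT, Colour.toSlice_eq_inl] at hx

theorem extendTiling_eq_some_head_iff {φ : ↥(S ∪ T)ᶜ → Colour n} {x : Box m} {k : Fin n} :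
    extendTiling φ x = some (Sum.inl (some k)) ↔ ∃ y : ↥(S ∪ T)ᶜ, ↑y = x ∧ φ y = Colour.head k := by
  constructor
  · intro h
    have hx : x ∈ (S ∪ T)ᶜ := by
      by_contra hx
      rw [Finset.mem_compl, not_not, Finset.mem_union] at hx
      by_cases hS : x ∈ S
      · simp [extendTiling, hS] at h
      · simp [extendTiling, hS, hx.resolve_left hS] at h
    rw [extendTiling_coe φ ⟨x, hx⟩, Colour.toSlice_eq_inl] at h
    obtain ⟨j, hj, h⟩ := h
    obtain rfl := Option.some_injective _ hj
    exact ⟨⟨x, hx⟩, rfl, h⟩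
  · rintro ⟨y, rfl, hy⟩
    rw [extendTiling_coe, hy]
    rfl

theorem extendTiling_eq_some_tail_iff {φ : ↥(S ∪ T)ᶜ → Colour n} {x : Box m} {k : Fin n} :
    extendTiling φ x = some (Sum.inr (some k)) ↔ ∃ y : ↥(S ∪ T)ᶜ, ↑y = x ∧ φ y = Colour.tail k := by
  constructor
  · intro h
    have hx : x ∈ (S ∪ T)ᶜ := by
      by_contra hx
      rw [Finset.mem_compl, not_not, Finset.mem_union] at hx
      by_cases hS : x ∈ S
      · simp [extendTiling, hS] at h
      · simp [extendTiling, hS, hx.resolve_left hS] at h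
    rw [extendTiling_coe φ ⟨x, hx⟩, Colour.toSlice_eq_inr] at h
    obtain ⟨j, hj, h⟩ := h
    obtain rfl := Option.some_injective _ hj
    exact ⟨⟨x, hx⟩, rfl, h⟩
  · rintro ⟨y, rfl, hy⟩
    rw [extendTiling_coe, hy]
    rfl

theorem extendTiling_eq_none_iff {φ : ↥(S ∪ T)ᶜ → Colour n} {x : Box m} :
    extendTiling φ x = none ↔ ∃ y : ↥(S ∪ T)ᶜ, ↑y = x ∧ φ y = Colour.monomer := by
  constructor
  · intro h
    have hx : x ∈ (S ∪ T)ᶜ := by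
      by_contra hx
      rw [Finset.mem_compl, not_not, Finset.mem_union] at hx
      by_cases hS : x ∈ S
      · simp [extendTiling, hS] at h
      · simp [extendTiling, hS, hx.resolve_left hS] at h
    rw [extendTiling_coe φ ⟨x, hx⟩, Colour.toSlice_eq_none] at h
    exact ⟨⟨x, hx⟩, rfl, h⟩
  · rintro ⟨y, rfl, hy⟩
    rw [extendTiling_coe, hy]
    rfl

/-- The tiling condition looks forward from heads and backward from tails. Since `torusStep` is a
bijection, both amount to one equivalence per step; points of `S ∪ T` carry no colour of an in-slice
direction, so partners automatically lie in the complement. -/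
theorem mem_torusTilings_iff_extendTiling {φ : ↥(S ∪ T)ᶜ → Colour n} :
    φ ∈ torusTilings (S ∪ T)ᶜ ↔
      ∀ (k : Fin n) (x y : Box m), PeriodicStep (fun _ => true) k x y →
        (extendTiling φ x = some (Sum.inl (some k)) ↔
          extendTiling φ y = some (Sum.inr (some k))) := by
  simp only [periodicStep_torus_iff, extendTiling_eq_some_head_iff, extendTiling_eq_some_tail_iff]
  constructor
  · rintro h k x _ rfl
    constructor
    · rintro ⟨z, rfl, hz⟩
      exact (h z k).1 hz
    · rintro ⟨z, hzx, hz⟩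
      obtain ⟨w, hw, hw'⟩ := (h z k).2 hz
      exact ⟨w, torusStep_injective k (hw.symm.trans hzx), hw'⟩
  · intro h x k
    refine ⟨fun hx => (h k x _ rfl).1 ⟨x, rfl, hx⟩, fun hx => ?_⟩
    obtain ⟨z, hz⟩ := torusStep_surjective k (x : Box m)
    obtain ⟨w, rfl, hw'⟩ := (h k z x hz.symm).2 ⟨x, rfl, hx⟩
    exact ⟨w, hz.symm, hw'⟩

theorem extendTiling_injective :
    Function.Injective (extendTiling : (↥(S ∪ T)ᶜ → Colour n) → Box m → SliceColour n) := by
  intro φ φ' h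
  funext x
  have := congrFun h x
  rw [extendTiling_coe, extendTiling_coe] at this
  exact Colour.toSlice_injective this

theorem extendTiling_restrict {ψ : Box m → SliceColour n}
    (hS : ∀ x, ψ x = some (Sum.inr none) ↔ x ∈ S) (hT : ∀ x, ψ x = some (Sum.inl none) ↔ x ∈ T) :
    extendTiling (fun x : ↥(S ∪ T)ᶜ => (ψ x).toColour) = ψ := by
  funext x
  by_cases h1 : x ∈ S
  · rw [extendTiling_of_mem_left h1, (hS x).2 h1]
  by_cases h2 : x ∈ T
  · simp [extendTiling, h1, h2, (hT x).2 h2]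
  · rw [extendTiling_coe (fun x : ↥(S ∪ T)ᶜ => (ψ x).toColour) ⟨x, by simp [h1, h2]⟩]
    exact SliceColour.toSlice_toColour (by rwa [Ne, hT]) (by rwa [Ne, hS])

end Extend

/-- A slice colouring is determined by its incoming set, its outgoing set and a tiling of the rest.
The two sets are disjoint because a point has one colour. -/
theorem sliceMatrix_torus_apply (D : Prop) {n : ℕ} (m : Fin n → ℕ) (S T : Finset (Box m)) :
    sliceMatrix D (fun _ => true) m S T =
      if S ∩ T = ∅ then {φ ∈ torusTilings (S ∪ T)ᶜ | D → ∀ x, φ x ≠ Colour.monomer}.ncard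
      else 0 := by
  rw [sliceMatrix, stateMatrix_apply]
  split_ifs with h
  · rw [← Nat.card_coe_set_eq]
    symm
    refine Nat.card_congr (Equiv.ofBijective (fun φ => ⟨⟨extendTiling φ.1,
      mem_torusTilings_iff_extendTiling.1 φ.2.1, fun hD x hx => ?_⟩, ?_, ?_⟩) ⟨?_, ?_⟩)
    · obtain ⟨y, -, hy⟩ := extendTiling_eq_none_iff.1 hx
      exact φ.2.2 hD y hy
    · ext x
      simp [extendTiling_eq_tail_iff]
    · ext x
      simp [extendTiling_eq_head_iff h]
    · intro φ φ' hφ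
      exact Subtype.ext (extendTiling_injective (congrArg (fun ψ => ψ.1.1) hφ))
    · rintro ⟨ψ, rfl, rfl⟩
      have e := extendTiling_restrict (ψ := ψ.1) (S := ψ.left) (T := ψ.right)
        (fun x => SliceColouring.mem_left.symm) (fun x => SliceColouring.mem_right.symm)
      refine ⟨⟨_, mem_torusTilings_iff_extendTiling.2 (by rw [e]; exact ψ.2.1),
        fun hD x hx => ψ.2.2 hD x ?_⟩, Subtype.ext (Subtype.ext e)⟩
      rw [← e]
      exact extendTiling_eq_none_iff.2 ⟨x, rfl, hx⟩
  · refine @Nat.card_of_isEmpty _ ⟨?_⟩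
    rintro ⟨ψ, rfl, rfl⟩
    obtain ⟨x, hx⟩ := Finset.nonempty_iff_ne_empty.2 h
    rw [Finset.mem_inter, SliceColouring.mem_left, SliceColouring.mem_right] at hx
    rw [hx.1] at hx
    simp at hx

theorem transferMatrix_eq {n : ℕ} (m : Fin n → ℕ) :
    transferMatrix m = sliceMatrix False (fun _ => true) m := by
  ext S T
  rw [sliceMatrix_torus_apply]
  simp [transferMatrix]

theorem dimerTransferMatrix_eq {n : ℕ} (m : Fin n → ℕ) :
    dimerTransferMatrix m = sliceMatrix True (fun _ => true) m := by
  ext S T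
  rw [sliceMatrix_torus_apply]
  simp [dimerTransferMatrix, torusDimerTilings]

/-! ### Existence of the entropies -/

section Counting

variable (D : Prop) {d : ℕ}

/-- Fill every line in the open direction `k` with consecutive dimers; on lines of odd length the
last one protrudes. -/
theorem ncard_periodicCovers_pos {per : Fin d → Bool} (m : Fin d → ℕ) {k : Fin d}
    (hk : per k = false) : 0 < (periodicCovers D per m).ncard := by
  rw [Set.ncard_pos]
  refine ⟨fun x => if Even (x k : ℕ) then Colour.head k else Colour.tail k, fun q x y hxy => ?_,
    fun _ x => by dsimp only; split_ifs <;> simp⟩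
  dsimp only [NeighbourRel]
  by_cases hq : q = k
  · subst hq
    have hs := hxy.1
    rw [hk] at hs
    have hs : (y q : ℕ) = x q + 1 := hs
    by_cases h : Even (x q : ℕ) <;> simp [hs, Nat.even_add_one, h]
  · have hq' : ¬ k = q := fun h => hq h.symm
    split_ifs <;> simp [hq']

theorem card_box (m : Fin d → ℕ) : Fintype.card (Box m) = ∏ k, m k := by
  simp [Box]

theorem ncard_periodicCovers_le (per : Fin d → Bool) (m : Fin d → ℕ) :
    (periodicCovers D per m).ncard ≤ (2 * d + 1) ^ ∏ k, m k := by
  refine (Set.ncard_le_card _).trans (le_of_eq ?_)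
  rw [Nat.card_eq_fintype_card, Fintype.card_fun, card_box]
  simp [two_mul]

/-- `log #W / |m|` for the periodic covers. -/
noncomputable def periodicRate (per : Fin d → Bool) (m : Fin d → ℕ) : ℝ :=
  Real.log ((periodicCovers D per m).ncard : ℝ) / ((∏ k, m k : ℕ) : ℝ)

theorem periodicRate_nonneg (per : Fin d → Bool) (m : Fin d → ℕ) : 0 ≤ periodicRate D per m :=
  div_nonneg (Real.log_natCast_nonneg _) (Nat.cast_nonneg _)

end Counting

theorem sum_entries_mul_le {ι : Type*} [Fintype ι] (A B : Matrix ι ι ℕ) :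
    ∑ i, ∑ j, (A * B) i j ≤ (∑ i, ∑ j, A i j) * ∑ i, ∑ j, B i j := by
  simp only [Matrix.mul_apply, Finset.sum_mul]
  refine Finset.sum_le_sum fun i _ => ?_
  rw [Finset.sum_comm]
  refine Finset.sum_le_sum fun j _ => ?_
  rw [← Finset.mul_sum]
  exact Nat.mul_le_mul_left _
    (Finset.single_le_sum (f := fun i => ∑ k, B i k) (fun _ _ => Nat.zero_le _) (Finset.mem_univ j))

theorem sum_entries_pow_mul_add_le {ι : Type*} [Fintype ι] [DecidableEq ι] (A : Matrix ι ι ℕ)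
    (a b c : ℕ) : ∑ i, ∑ j, (A ^ (a * c + b)) i j ≤
      (∑ i, ∑ j, (A ^ c) i j) ^ a * ∑ i, ∑ j, (A ^ b) i j := by
  induction a with
  | zero => simp
  | succ a ih =>
    rw [show (a + 1) * c + b = c + (a * c + b) by ring, pow_add, pow_succ', mul_assoc]
    exact (sum_entries_mul_le _ _).trans (Nat.mul_le_mul_left _ ih)

section Fekete

variable (D : Prop) {d : ℕ} {per : Fin (d + 1) → Bool} {m : Fin (d + 1) → ℕ} {k : Fin (d + 1)}

/-- A cover restricts to covers of `a` blocks of length `c` and one of length `b`, and is determined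
by these restrictions. -/
theorem ncard_periodicCovers_le_pow_mul (hk : per k = false) {a b c : ℕ} (hb : b ≠ 0) (hc : c ≠ 0)
    (hm : m k = a * c + b) :
    (periodicCovers D per m).ncard ≤ (periodicCovers D per (Function.update m k c)).ncard ^ a *
      (periodicCovers D per (Function.update m k b)).ncard := by
  have h (e : ℕ) (he : e ≠ 0) := ncard_periodicCovers_eq_sum D (m := Function.update m k e) k hk
    (by simpa using he) (fun _ => rfl) (m' := fun j => m (k.succAbove j)) (fun j => by simp)
  rw [ncard_periodicCovers_eq_sum D k hk (by omega) (fun _ => rfl) (fun _ => rfl), hm,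
    h b hb, h c hc]
  simp only [Function.update_self]
  exact sum_entries_pow_mul_add_le _ _ _ _

/-- One coordinate of Fekete's argument. The error is the remainder block of length at most `c`,
bounded by allowing all colours at each of its points. -/
theorem periodicRate_le_update (hk : per k = false) (hm : ∀ j, m j ≠ 0) {c : ℕ} (hc : c ≠ 0) :
    periodicRate D per m ≤ periodicRate D per (Function.update m k c) +
      Real.log (2 * (d + 1 : ℕ) + 1) * c / m k := by
  -- The remainder is taken in 1, …, c rather than 0, …, c - 1, because the sum of entries counts
  -- covers only for nonzero length.
  obtain ⟨a, b, hb, hbc, hab⟩ : ∃ a b, b ≠ 0 ∧ b ≤ c ∧ m k = a * c + b := by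
    have h1 := hm k
    refine ⟨(m k - 1) / c, (m k - 1) % c + 1, by omega,
      Nat.mod_lt _ (Nat.pos_of_ne_zero hc), ?_⟩
    have := Nat.div_add_mod' (m k - 1) c
    omega
  set P : ℕ := ∏ j, m (k.succAbove j) with hP
  have hPpos : 0 < P := Finset.prod_pos fun j _ => Nat.pos_of_ne_zero (hm _)
  have prod (e : ℕ) : ∏ j, Function.update m k e j = e * P := by
    rw [Fin.prod_univ_succAbove _ k]
    simp [hP]
  have prodm : ∏ j, m j = m k * P := Fin.prod_univ_succAbove _ k
  have h1 : Real.log ((periodicCovers D per m).ncard : ℝ) ≤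
      a * Real.log ((periodicCovers D per (Function.update m k c)).ncard : ℝ) +
        Real.log ((periodicCovers D per (Function.update m k b)).ncard : ℝ) := by
    have hpos (m' : Fin (d + 1) → ℕ) : ((periodicCovers D per m').ncard : ℝ) ≠ 0 :=
      Nat.cast_ne_zero.2 (ncard_periodicCovers_pos D m' hk).ne'
    rw [← Real.log_pow, ← Real.log_mul (pow_ne_zero _ (hpos _)) (hpos _)]
    refine Real.log_le_log (Nat.cast_pos.2 (ncard_periodicCovers_pos D m hk)) ?_
    exact_mod_cast ncard_periodicCovers_le_pow_mul D hk hb hc hab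
  have h2 : Real.log ((periodicCovers D per (Function.update m k b)).ncard : ℝ) ≤
      (b * P : ℕ) * Real.log (2 * (d + 1 : ℕ) + 1) := by
    rw [← Real.log_pow]
    refine Real.log_le_log
      (Nat.cast_pos.2 (ncard_periodicCovers_pos D (Function.update m k b) hk)) ?_
    have := ncard_periodicCovers_le D per (Function.update m k b)
    rw [prod] at this
    exact_mod_cast this
  have hlog : 0 ≤ Real.log (2 * (d + 1 : ℕ) + 1) := by
    apply Real.log_nonneg
    have : (0 : ℝ) ≤ (d + 1 : ℕ) := Nat.cast_nonneg _
    linarith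
  have hG : 0 ≤ Real.log ((periodicCovers D per (Function.update m k c)).ncard : ℝ) :=
    Real.log_natCast_nonneg _
  rw [periodicRate, periodicRate, prod, prodm]
  push_cast at h2 hlog ⊢
  have hP0 : (0 : ℝ) < P := Nat.cast_pos.2 hPpos
  have hc0 : (0 : ℝ) < c := Nat.cast_pos.2 (Nat.pos_of_ne_zero hc)
  have hn0 : (0 : ℝ) < m k := Nat.cast_pos.2 (Nat.pos_of_ne_zero (hm k))
  have hac : (a : ℝ) * c ≤ m k := by exact_mod_cast (by omega : a * c ≤ m k)
  have hbc' : (b : ℝ) ≤ c := by exact_mod_cast hbc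
  rw [div_le_iff₀ (mul_pos hn0 hP0)]
  generalize Real.log ((periodicCovers D per (Function.update m k c)).ncard : ℝ) = G at *
  generalize Real.log (2 * ((d : ℝ) + 1) + 1) = E at *
  have e : (G / (c * P) + E * c / m k) * (m k * P) = G * m k / c + E * c * P := by
    field_simp
  rw [e]
  have h3 : a * G ≤ G * m k / c := by
    rw [le_div_iff₀ hc0]
    nlinarith
  have h4 : b * P * E ≤ E * c * P := by
    nlinarith [mul_le_mul_of_nonneg_right hbc' (mul_nonneg hP0.le hlog)]
  linarith

theorem periodicRate_le_piecewise {m₀ : Fin (d + 1) → ℕ} (hm : ∀ j, m j ≠ 0) (hm₀ : ∀ j, m₀ j ≠ 0)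
    (s : Finset (Fin (d + 1))) :
    periodicRate D (fun _ => false) m ≤ periodicRate D (fun _ => false) (s.piecewise m₀ m) +
      ∑ k ∈ s, Real.log (2 * (d + 1 : ℕ) + 1) * m₀ k / m k := by
  induction s using Finset.induction_on with
  | empty => simp
  | insert k s hk ih =>
    rw [Finset.piecewise_insert, Finset.sum_insert hk]
    have h := periodicRate_le_update D (per := fun _ => false) (k := k) (m := s.piecewise m₀ m) rfl
      (fun j => by by_cases hj : j ∈ s <;> simp [hj, hm, hm₀]) (hm₀ k)
    rw [Finset.piecewise_eq_of_notMem _ _ _ hk] at h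
    linarith

theorem tendsto_apply_atTop {ι : Type*} (k : ι) :
    Tendsto (fun m : ι → ℕ => m k) atTop atTop :=
  tendsto_atTop.2 fun b => (eventually_ge_atTop fun _ => b).mono fun _ hm => hm k

/-- The limit is the infimum of the rates over boxes with nonzero sides: a box of nearly optimal
rate controls all sufficiently large boxes. -/
theorem exists_tendsto_periodicRate (d : ℕ) :
    ∃ h, Tendsto (fun m : Fin (d + 1) → ℕ => periodicRate D (fun _ => false) m) atTop (𝓝 h) := by
  set s : Set ℝ := periodicRate D (fun _ => false) '' {m : Fin (d + 1) → ℕ | ∀ j, m j ≠ 0}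
  have hs : s.Nonempty := ⟨_, fun _ => 1, by simp, rfl⟩
  have hb : BddBelow s := ⟨0, by
    rintro _ ⟨m, -, rfl⟩
    exact periodicRate_nonneg D _ m⟩
  have hpos : ∀ᶠ m : Fin (d + 1) → ℕ in atTop, ∀ j, m j ≠ 0 :=
    (eventually_ge_atTop fun _ => 1).mono fun m hm j => Nat.one_le_iff_ne_zero.1 (hm j)
  refine ⟨sInf s, tendsto_order.2 ⟨fun a ha => ?_, fun a ha => ?_⟩⟩
  · exact hpos.mono fun m hm => ha.trans_le (csInf_le hb ⟨m, hm, rfl⟩)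
  · obtain ⟨_, ⟨m₀, hm₀, rfl⟩, h₀⟩ := exists_lt_of_csInf_lt hs ha
    have ht : Tendsto (fun m : Fin (d + 1) → ℕ => periodicRate D (fun _ => false) m₀ +
        ∑ k, Real.log (2 * (d + 1 : ℕ) + 1) * m₀ k / m k) atTop
        (𝓝 (periodicRate D (fun _ => false) m₀ + ∑ _k : Fin (d + 1), 0)) :=
      tendsto_const_nhds.add (tendsto_finsetSum _ fun k _ =>
        ((tendsto_natCast_atTop_atTop (R := ℝ)).comp (tendsto_apply_atTop k)).const_div_atTop _)
    rw [Finset.sum_const_zero, add_zero] at ht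
    filter_upwards [hpos, ht.eventually_lt_const h₀] with m hm hlt
    refine lt_of_le_of_lt ?_ hlt
    simpa using periodicRate_le_piecewise D hm hm₀ Finset.univ

end Fekete

/-! ### Logarithmic inequalities between spectral radii and counts -/

section Logarithms

variable (D : Prop) {d : ℕ}

/-- The logarithm of the spectral radius of the transfer matrix. -/
noncomputable def logRadius (per : Fin d → Bool) (m : Fin d → ℕ) : ℝ :=
  Real.log (matrixRadius (sliceMatrix D per m))

theorem log_card_finset_box (m : Fin d → ℕ) :
    Real.log (Fintype.card (Finset (Box m))) = (∏ k, m k : ℕ) * Real.log 2 := by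
  rw [Fintype.card_finset, card_box]
  push_cast
  rw [Real.log_pow]
  push_cast
  rfl

/-- Radius zero would make all entries vanish, but their sum counts the covers of a layer of
thickness one, which exist. -/
theorem matrixRadius_sliceMatrix_pos (per : Fin d → Bool) (m : Fin d → ℕ) :
    0 < matrixRadius (sliceMatrix D per m) := by
  refine (matrixRadius_nonneg _).lt_of_ne' fun h => ?_
  have h1 := ncard_periodicCovers_pos D (per := Fin.cons false per)
    (Fin.cons 1 m : Fin (d + 1) → ℕ) (k := 0) rfl
  rw [ncard_periodicCovers_eq_sum D (0 : Fin (d + 1)) (per' := per) (m' := m) rfl (by simp)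
    (fun j => by simp) (fun j => by simp)] at h1
  have h2 := sum_entries_pow_le (sliceMatrix_isSymm D per m) 1
  rw [h] at h2
  simp only [Fin.cons_zero] at h1
  have h3 : (0 : ℝ) < ((∑ S, ∑ R, (sliceMatrix D per m ^ 1) S R : ℕ) : ℝ) := by exact_mod_cast h1
  simp only [pow_one, mul_zero] at h2 h3
  linarith

theorem mul_logRadius_le_log_trace (per : Fin d → Bool) (m : Fin d → ℕ) {n : ℕ} (hn : Even n) :
    n * logRadius D per m ≤ Real.log ((sliceMatrix D per m ^ n).trace : ℕ) := by
  rw [logRadius, ← Real.log_pow]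
  exact Real.log_le_log (pow_pos (matrixRadius_sliceMatrix_pos D per m) n)
    (matrixRadius_pow_le_trace (sliceMatrix_isSymm D per m) hn)

theorem trace_sliceMatrix_pow_pos (per : Fin d → Bool) (m : Fin d → ℕ) {n : ℕ} (hn : Even n) :
    (0 : ℝ) < ((sliceMatrix D per m ^ n).trace : ℕ) :=
  (pow_pos (matrixRadius_sliceMatrix_pos D per m) n).trans_le
    (matrixRadius_pow_le_trace (sliceMatrix_isSymm D per m) hn)

theorem log_trace_le (per : Fin d → Bool) (m : Fin d → ℕ) {n : ℕ} (hn : Even n) :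
    Real.log ((sliceMatrix D per m ^ n).trace : ℕ) ≤
      (∏ k, m k : ℕ) * Real.log 2 + n * logRadius D per m := by
  rw [← log_card_finset_box, logRadius, ← Real.log_pow, ← Real.log_mul (by simp)
    (pow_pos (matrixRadius_sliceMatrix_pos D per m) n).ne']
  exact Real.log_le_log (trace_sliceMatrix_pow_pos D per m hn)
    (trace_pow_le (sliceMatrix_isSymm D per m) n)

/-- The engine of the lower bounds; the trace identity will come from slicing one torus along two
directions. -/
theorem mul_logRadius_le_of_trace_eq {d' : ℕ} {per : Fin d → Bool} {per' : Fin d' → Bool}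
    {m : Fin d → ℕ} {m' : Fin d' → ℕ} {n p q : ℕ} (hn : Even n)
    (h : (sliceMatrix D per m ^ n).trace = (sliceMatrix D per' m' ^ (p + 2 * q)).trace) :
    n * logRadius D per m ≤
      p * logRadius D per' m' + Real.log ((sliceMatrix D per' m' ^ (2 * q)).trace : ℕ) := by
  refine (mul_logRadius_le_log_trace D per m hn).trans ?_
  rw [logRadius, ← Real.log_pow,
    ← Real.log_mul (pow_pos (matrixRadius_sliceMatrix_pos D per' m') p).ne'
      (trace_sliceMatrix_pow_pos D per' m' (even_two_mul q)).ne']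
  refine Real.log_le_log (trace_sliceMatrix_pow_pos D per m hn) ?_
  rw [h]
  exact trace_pow_add_le (sliceMatrix_isSymm D per' m') p (even_two_mul q)

theorem mul_logRadius_le_log_ncard {m : Fin (d + 1) → ℕ} (k : Fin (d + 1)) (hk : m k ≠ 0)
    (hk' : Even (m k)) {m' : Fin d → ℕ} (hm' : ∀ j, m (k.succAbove j) = m' j) :
    m k * logRadius D (fun _ => true) m' ≤
      Real.log ((periodicCovers D (fun _ => false) m).ncard : ℝ) := by
  refine (mul_logRadius_le_log_trace D _ m' hk').trans ?_
  refine Real.log_le_log (trace_sliceMatrix_pow_pos D _ m' hk') ?_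
  rw [← ncard_periodicCovers_eq_trace D (per := fun _ => true) k rfl hk (fun _ => rfl) hm']
  exact_mod_cast Set.ncard_le_ncard (periodicCovers_anti D (fun _ => by simp) m)

theorem periodicRate_le_logRadius {per : Fin (d + 1) → Bool} {m : Fin (d + 1) → ℕ}
    (k : Fin (d + 1)) (hk : per k = false) (hm : ∀ j, m j ≠ 0)
    {per' : Fin d → Bool} {m' : Fin d → ℕ} (hper' : ∀ j, per (k.succAbove j) = per' j)
    (hm' : ∀ j, m (k.succAbove j) = m' j) :
    periodicRate D per m ≤ 3 * Real.log 2 / m k + logRadius D per' m' / (∏ j, m' j : ℕ) := by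
  have hprod : ∏ j, m j = m k * ∏ j, m' j := by
    rw [Fin.prod_univ_succAbove _ k]
    simp only [hm']
  have hP : (0 : ℝ) < (∏ j, m' j : ℕ) :=
    Nat.cast_pos.2 (Finset.prod_pos fun j _ => hm' j ▸ Nat.pos_of_ne_zero (hm _))
  have hn : (0 : ℝ) < m k := Nat.cast_pos.2 (Nat.pos_of_ne_zero (hm k))
  have h : Real.log ((periodicCovers D per m).ncard : ℝ) ≤
      3 * ((∏ j, m' j : ℕ) * Real.log 2) + m k * logRadius D per' m' := by
    rw [← log_card_finset_box, logRadius, ← Real.log_pow,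
      -- The exponent 3 is that of the matrix size in `sum_entries_pow_le`.
      show (3 : ℝ) * Real.log (Fintype.card (Finset (Box m'))) =
        Real.log ((Fintype.card (Finset (Box m')) : ℝ) ^ 3) by rw [Real.log_pow]; norm_num,
      ← Real.log_mul (by simp) (pow_pos (matrixRadius_sliceMatrix_pos D per' m') _).ne']
    refine Real.log_le_log (Nat.cast_pos.2 (ncard_periodicCovers_pos D m hk)) ?_
    rw [ncard_periodicCovers_eq_sum D k hk (hm k) hper' hm']
    exact sum_entries_pow_le (sliceMatrix_isSymm D per' m') _
  rw [periodicRate, hprod, Nat.cast_mul, div_le_iff₀ (mul_pos hn hP)]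
  refine h.trans (le_of_eq ?_)
  field_simp

theorem logRadius_le_periodicRate {per : Fin (d + 1) → Bool} {m : Fin (d + 1) → ℕ}
    (k : Fin (d + 1)) (hk : per k = true) (hk' : Even (m k)) (hm : ∀ j, m j ≠ 0)
    {per' : Fin d → Bool} {m' : Fin d → ℕ} (hper' : ∀ j, per (k.succAbove j) = per' j)
    (hm' : ∀ j, m (k.succAbove j) = m' j) :
    logRadius D per' m' / (∏ j, m' j : ℕ) ≤ periodicRate D per m := by
  have hprod : ∏ j, m j = m k * ∏ j, m' j := by
    rw [Fin.prod_univ_succAbove _ k]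
    simp only [hm']
  have hP : (0 : ℝ) < (∏ j, m' j : ℕ) :=
    Nat.cast_pos.2 (Finset.prod_pos fun j _ => hm' j ▸ Nat.pos_of_ne_zero (hm _))
  have hn : (0 : ℝ) < m k := Nat.cast_pos.2 (Nat.pos_of_ne_zero (hm k))
  rw [periodicRate, ncard_periodicCovers_eq_trace D k hk (hm k) hper' hm', hprod, Nat.cast_mul,
    div_le_div_iff₀ hP (mul_pos hn hP)]
  have h := mul_logRadius_le_log_trace D per' m' hk'
  nlinarith [mul_le_mul_of_nonneg_right h hP.le]

/-- Making direction `k` periodic with an even period. -/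
theorem periodicRate_le_periodicRate {per per' : Fin (d + 1) → Bool} {m m' : Fin (d + 1) → ℕ}
    (k : Fin (d + 1)) (hk : per k = false) (hk' : per' k = true) (he : Even (m' k))
    (hm : ∀ j, m j ≠ 0) (hm' : ∀ j, m' j ≠ 0)
    (hper : ∀ j, per' (k.succAbove j) = per (k.succAbove j))
    (hmm : ∀ j, m' (k.succAbove j) = m (k.succAbove j)) :
    periodicRate D per m ≤ 3 * Real.log 2 / m k + periodicRate D per' m' :=
  (periodicRate_le_logRadius D k hk hm (fun _ => rfl) (fun _ => rfl)).trans
    (add_le_add le_rfl (logRadius_le_periodicRate D k hk' he hm' hper hmm))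

end Logarithms

/-! ### The bounds in dimensions two and three -/

section Bounds

variable (D : Prop)

/-- `log β(m)` in dimension one, with the convention `β(0) = 2`. -/
noncomputable def logBeta₁ (m : ℕ) : ℝ :=
  if m = 0 then Real.log 2 else logRadius D (fun _ => true) ![m]

/-- `log β(m, n)` in dimension two, with the convention `β(m, 0) = 2 ^ m`, `β(0, n) = 2 ^ n`. -/
noncomputable def logBeta₂ (m n : ℕ) : ℝ :=
  if n = 0 then m * Real.log 2 else if m = 0 then n * Real.log 2 else
    logRadius D (fun _ => true) ![m, n]

theorem logBeta₁_of_ne_zero {m : ℕ} (hm : m ≠ 0) :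
    logBeta₁ D m = logRadius D (fun _ => true) ![m] := by
  simp [logBeta₁, hm]

theorem logBeta₂_of_ne_zero {m n : ℕ} (hm : m ≠ 0) (hn : n ≠ 0) :
    logBeta₂ D m n = logRadius D (fun _ => true) ![m, n] := by
  simp [logBeta₂, hm, hn]

/-- Both sides count the covers of the a × b torus. -/
theorem trace_pow_swap₁ {a b : ℕ} (ha : a ≠ 0) (hb : b ≠ 0) :
    (sliceMatrix D (fun _ => true) ![a] ^ b).trace =
      (sliceMatrix D (fun _ => true) ![b] ^ a).trace := by
  have h1 := ncard_periodicCovers_eq_trace D (per := fun _ => true) (m := ![a, b]) 1 rfl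
    (by simpa) (per' := fun _ => true) (m' := ![a]) (fun _ => rfl)
    (fun j => by fin_cases j; rfl)
  have h2 := ncard_periodicCovers_eq_trace D (per := fun _ => true) (m := ![a, b]) 0 rfl
    (by simpa) (per' := fun _ => true) (m' := ![b]) (fun _ => rfl)
    (fun j => by fin_cases j; rfl)
  exact h1.symm.trans h2

theorem trace_pow_swap_right {a b c : ℕ} (hb : b ≠ 0) (hc : c ≠ 0) :
    (sliceMatrix D (fun _ => true) ![a, b] ^ c).trace =
      (sliceMatrix D (fun _ => true) ![a, c] ^ b).trace := by
  have h1 := ncard_periodicCovers_eq_trace D (per := fun _ => true) (m := ![a, b, c]) 2 rfl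
    (by simpa) (per' := fun _ => true) (m' := ![a, b]) (fun _ => rfl)
    (fun j => by fin_cases j <;> rfl)
  have h2 := ncard_periodicCovers_eq_trace D (per := fun _ => true) (m := ![a, b, c]) 1 rfl
    (by simpa) (per' := fun _ => true) (m' := ![a, c]) (fun _ => rfl)
    (fun j => by fin_cases j <;> rfl)
  exact h1.symm.trans h2

theorem trace_pow_rotate {a b c : ℕ} (ha : a ≠ 0) (hc : c ≠ 0) :
    (sliceMatrix D (fun _ => true) ![a, b] ^ c).trace =
      (sliceMatrix D (fun _ => true) ![b, c] ^ a).trace := by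
  have h1 := ncard_periodicCovers_eq_trace D (per := fun _ => true) (m := ![a, b, c]) 2 rfl
    (by simpa) (per' := fun _ => true) (m' := ![a, b]) (fun _ => rfl)
    (fun j => by fin_cases j <;> rfl)
  have h2 := ncard_periodicCovers_eq_trace D (per := fun _ => true) (m := ![a, b, c]) 0 rfl
    (by simpa) (per' := fun _ => true) (m' := ![b, c]) (fun _ => rfl)
    (fun j => by fin_cases j <;> rfl)
  exact h1.symm.trans h2

theorem log_trace_one {d : ℕ} (per : Fin d → Bool) (m : Fin d → ℕ) :
    Real.log ((sliceMatrix D per m ^ 0).trace : ℕ) = (∏ k, m k : ℕ) * Real.log 2 := by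
  rw [pow_zero, Matrix.trace_one, Nat.cast_id, log_card_finset_box]

/-- For q > 0, exchange side and exponent. For q = 0 the trace is the matrix size 2^x, which is
β(0)^x by convention. -/
theorem log_trace_le_logBeta₁ {x : ℕ} (hx : x ≠ 0) (hx' : Even x) (q : ℕ) :
    Real.log ((sliceMatrix D (fun _ => true) ![x] ^ (2 * q)).trace : ℕ) ≤
      2 * q * Real.log 2 + x * logBeta₁ D (2 * q) := by
  obtain rfl | hq := Nat.eq_zero_or_pos q
  · rw [mul_zero, log_trace_one]
    simp [logBeta₁]
  · rw [trace_pow_swap₁ D hx (by omega), logBeta₁_of_ne_zero D (by omega)]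
    simpa using log_trace_le D (fun _ => true) ![2 * q] hx'

theorem log_trace_le_logBeta₂_right {x : ℕ} (hx : x ≠ 0) (hx' : Even x)
    {a : ℕ} (ha : a ≠ 0) (s : ℕ) :
    Real.log ((sliceMatrix D (fun _ => true) ![a, x] ^ (2 * s)).trace : ℕ) ≤
      a * (2 * s) * Real.log 2 + x * logBeta₂ D a (2 * s) := by
  obtain rfl | hs := Nat.eq_zero_or_pos s
  · rw [mul_zero, log_trace_one]
    simp [logBeta₂]
    linarith
  · rw [trace_pow_swap_right D hx (by omega), logBeta₂_of_ne_zero D ha (by omega)]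
    simpa using log_trace_le D (fun _ => true) ![a, 2 * s] hx'

theorem log_trace_le_logBeta₂_left {x : ℕ} (hx : x ≠ 0) (hx' : Even x)
    {b : ℕ} (hb : b ≠ 0) (q : ℕ) :
    Real.log ((sliceMatrix D (fun _ => true) ![b, x] ^ (2 * q)).trace : ℕ) ≤
      2 * q * b * Real.log 2 + x * logBeta₂ D (2 * q) b := by
  obtain rfl | hq := Nat.eq_zero_or_pos q
  · rw [mul_zero, log_trace_one]
    simp [logBeta₂, hb]
    linarith
  · rw [← trace_pow_rotate D (by omega) hx, logBeta₂_of_ne_zero D (by omega) hb]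
    simpa using log_trace_le D (fun _ => true) ![2 * q, b] hx'

/-- Bounds log β(2q, x) / x by log β(2q, 2v) / (2v) up to O(1/x), which replaces the growing side x
by a fixed one. -/
theorem mul_logBeta₂_le {x : ℕ} (hx : x ≠ 0) (hx' : Even x) {v : ℕ} (hv : v ≠ 0) (q : ℕ) :
    2 * v * logBeta₂ D (2 * q) x ≤
      2 * q * (2 * v) * Real.log 2 + x * logBeta₂ D (2 * q) (2 * v) := by
  obtain rfl | hq := Nat.eq_zero_or_pos q
  · simp [logBeta₂, hx, hv]
    exact le_of_eq (by ring)
  · have h := mul_logRadius_le_log_trace D (fun _ => true) ![2 * q, x] (even_two_mul v)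
    rw [trace_pow_swap_right D hx (by omega)] at h
    rw [logBeta₂_of_ne_zero D (by omega) hx, logBeta₂_of_ne_zero D (by omega) (by omega)]
    have h' := log_trace_le D (fun _ => true) ![2 * q, 2 * v] hx'
    simp at h h'
    linarith

theorem logBeta₁_lower_bound {x : ℕ} (hx : x ≠ 0) (hx' : Even x) {p : ℕ} (hp : p ≠ 0) (q : ℕ) :
    logBeta₁ D (p + 2 * q) - logBeta₁ D (2 * q) ≤
      p * periodicRate D (fun _ => false) (fun _ : Fin 2 => x) + 2 * q * Real.log 2 / x := by
  have h1 := mul_logRadius_le_of_trace_eq D hx' (trace_pow_swap₁ D (a := p + 2 * q) (by omega) hx)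
  have h2 := log_trace_le_logBeta₁ D hx hx' q
  have h3 := mul_logRadius_le_log_ncard D (m := fun _ : Fin 2 => x) 0 hx hx' (m' := ![x])
    (fun j => by fin_cases j; rfl)
  rw [← logBeta₁_of_ne_zero D (by omega), ← logBeta₁_of_ne_zero D hx] at h1
  rw [← logBeta₁_of_ne_zero D hx] at h3
  have hx0 : (0 : ℝ) < x := Nat.cast_pos.2 (Nat.pos_of_ne_zero hx)
  simp only [periodicRate, Fin.prod_univ_two]
  push_cast
  generalize Real.log ((periodicCovers D (fun _ => false) fun _ : Fin 2 => x).ncard : ℝ) = W at *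
  have e : p * (W / (x * x)) + 2 * q * Real.log 2 / x = (p * (W / x) + 2 * q * Real.log 2) / x := by
    field_simp
  rw [e, le_div_iff₀ hx0]
  have h4 : p * logBeta₁ D x ≤ p * (W / x) :=
    mul_le_mul_of_nonneg_left ((le_div_iff₀ hx0).2 (by linarith)) (Nat.cast_nonneg _)
  linarith

/-- Exchanging u + 2s with x reduces to β(p+2q, x); exchanging p + 2q with x then reduces to β(x, x)
and β(2q, x). In the error, one 2q comes from tr B(2q, x)^x, the other from passing to β(2q, 2v),
and (p+2q)(2s) from tr B(p+2q, 2s)^x. -/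
theorem logBeta₂_lower_bound {x : ℕ} (hx : x ≠ 0) (hx' : Even x) {p u v : ℕ}
    (hp : p ≠ 0) (hu : u ≠ 0) (hv : v ≠ 0) (q s : ℕ) :
    logBeta₂ D (p + 2 * q) (u + 2 * s) - logBeta₂ D (p + 2 * q) (2 * s) ≤
      u * (p * periodicRate D (fun _ => false) (fun _ : Fin 3 => x) +
        logBeta₂ D (2 * q) (2 * v) / (2 * v)) +
      (u * (2 * q + 2 * q) + (p + 2 * q) * (2 * s)) * Real.log 2 / x := by
  have h1 := mul_logRadius_le_of_trace_eq D hx'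
    (trace_pow_swap_right D (a := p + 2 * q) (b := u + 2 * s) (by omega) hx)
  have h2 := log_trace_le_logBeta₂_right D hx hx' (a := p + 2 * q) (by omega) s
  have h3 := mul_logRadius_le_of_trace_eq D hx'
    (trace_pow_rotate D (a := p + 2 * q) (b := x) (by omega) hx)
  have h4 := log_trace_le_logBeta₂_left D hx hx' hx q
  have h5 := mul_logBeta₂_le D hx hx' hv q
  have h6 := mul_logRadius_le_log_ncard D (m := fun _ : Fin 3 => x) 0 hx hx' (m' := ![x, x])
    (fun j => by fin_cases j <;> rfl)
  rw [← logBeta₂_of_ne_zero D (by omega) (by omega), ← logBeta₂_of_ne_zero D (by omega) hx] at h1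
  rw [← logBeta₂_of_ne_zero D (by omega) hx, ← logBeta₂_of_ne_zero D hx hx] at h3
  rw [← logBeta₂_of_ne_zero D hx hx] at h6
  have hx0 : (0 : ℝ) < x := Nat.cast_pos.2 (Nat.pos_of_ne_zero hx)
  have hv0 : (0 : ℝ) < v := Nat.cast_pos.2 (Nat.pos_of_ne_zero hv)
  simp only [periodicRate, Fin.prod_univ_three]
  push_cast at h2 ⊢
  generalize Real.log ((periodicCovers D (fun _ => false) fun _ : Fin 3 => x).ncard : ℝ) = W at *
  generalize logBeta₂ D (2 * q) (2 * v) = B at *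
  generalize Real.log 2 = E at *
  have h7 : logBeta₂ D (2 * q) x ≤ 2 * q * E + x * (B / (2 * v)) := by
    have e : 2 * q * E + x * (B / (2 * v)) = (2 * q * (2 * v) * E + x * B) / (2 * v) := by
      field_simp
    rw [e, le_div_iff₀ (by positivity)]
    linarith
  have h8 : p * logBeta₂ D x x ≤ p * (W / x) :=
    mul_le_mul_of_nonneg_left ((le_div_iff₀ hx0).2 (by linarith)) (Nat.cast_nonneg _)
  have h9 : logBeta₂ D (p + 2 * q) x ≤
      p * (W / x) / x + 2 * q * E + (2 * q * E + x * (B / (2 * v))) := by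
    have e : p * (W / x) / x + 2 * q * E + (2 * q * E + x * (B / (2 * v))) =
        (p * (W / x) + 2 * q * x * E + x * (2 * q * E + x * (B / (2 * v)))) / x := by
      field_simp
    rw [e, le_div_iff₀ hx0]
    have := mul_le_mul_of_nonneg_left h7 hx0.le
    linarith
  have h10 := mul_le_mul_of_nonneg_left h9 (Nat.cast_nonneg u : (0 : ℝ) ≤ u)
  have e : u * (p * (W / (x * x * x)) + B / (2 * v)) +
      (u * (2 * q + 2 * q) + (p + 2 * q) * (2 * s)) * E / x =
      (u * (p * (W / x) / x + 2 * q * E + (2 * q * E + x * (B / (2 * v)))) +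
        (p + 2 * q) * (2 * s) * E) / x := by
    field_simp
    ring
  rw [e, le_div_iff₀ hx0]
  linarith

end Bounds

/-! ### Passing to the limit along cubes -/

section Limits

variable (D : Prop)

theorem tendsto_const_pi_atTop (d : ℕ) : Tendsto (fun (n : ℕ) (_ : Fin d) => n) atTop atTop :=
  tendsto_atTop.2 fun b => eventually_all.2 fun k => eventually_ge_atTop (b k)

theorem tendsto_two_mul_atTop : Tendsto (fun n : ℕ => 2 * n) atTop atTop :=
  tendsto_id.const_mul_atTop' (by norm_num)

theorem le_of_periodicRate_diagonal_le {d : ℕ} {h C L : ℝ}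
    (H : Tendsto (fun m : Fin d → ℕ => periodicRate D (fun _ => false) m) atTop (𝓝 h))
    (hL : ∀ n : ℕ, n ≠ 0 → periodicRate D (fun _ => false) (fun _ : Fin d => n) ≤ C / n + L) :
    h ≤ L := by
  have h1 : Tendsto (fun n : ℕ => C / n + L) atTop (𝓝 (0 + L)) :=
    (tendsto_const_div_atTop_nhds_zero_nat C).add_const L
  rw [zero_add] at h1
  exact le_of_tendsto_of_tendsto (H.comp (tendsto_const_pi_atTop d)) h1
    ((eventually_ne_atTop 0).mono hL)

/-- Even cubes suffice, since the limit over all boxes is already known to exist. -/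
theorem le_of_le_periodicRate_diagonal {d : ℕ} {h a b C L : ℝ}
    (H : Tendsto (fun m : Fin d → ℕ => periodicRate D (fun _ => false) m) atTop (𝓝 h))
    (hL : ∀ x : ℕ, x ≠ 0 → Even x →
      L ≤ a * periodicRate D (fun _ => false) (fun _ : Fin d => x) + b + C / x) :
    L ≤ a * h + b := by
  have h1 : Tendsto (fun x : ℕ => a * periodicRate D (fun _ => false) (fun _ : Fin d => x) + b +
      C / x) atTop (𝓝 (a * h + b + 0)) :=
    (((H.comp (tendsto_const_pi_atTop d)).const_mul a).add_const b).add
      (tendsto_const_div_atTop_nhds_zero_nat C)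
  rw [add_zero] at h1
  refine ge_of_tendsto (h1.comp tendsto_two_mul_atTop) ?_
  filter_upwards [eventually_ne_atTop 0] with n hn
  exact hL (2 * n) (by omega) (even_two_mul n)

theorem entropy_two_le {h : ℝ}
    (H : Tendsto (fun m : Fin 2 → ℕ => periodicRate D (fun _ => false) m) atTop (𝓝 h))
    {r : ℕ} (hr : r ≠ 0) : h ≤ logBeta₁ D (2 * r) / (2 * r) := by
  -- Each of the two directions costs 3 log 2 / n: direction 1 gets period 2r, and direction 0 is
  -- transferred along.
  refine le_of_periodicRate_diagonal_le D (C := 2 * (3 * Real.log 2)) H fun n hn => ?_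
  have h1 := periodicRate_le_periodicRate D (per := fun _ => false) (per' := ![false, true])
    (m := fun _ : Fin 2 => n) (m' := ![n, 2 * r]) 1 rfl rfl (even_two_mul r) (fun _ => hn)
    (by simp [Fin.forall_fin_succ, hn, hr]) (fun j => by fin_cases j; rfl)
    (fun j => by fin_cases j; rfl)
  have h2 := periodicRate_le_logRadius D (per := ![false, true]) (m := ![n, 2 * r])
    (per' := fun _ => true) (m' := ![2 * r]) 0 rfl
    (by simp [Fin.forall_fin_succ, hn, hr]) (fun j => by fin_cases j; rfl)
    (fun j => by fin_cases j; rfl)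
  rw [← logBeta₁_of_ne_zero D (by omega)] at h2
  simp only [Fin.prod_univ_succ, Matrix.cons_val_zero, Finset.univ_eq_empty, Finset.prod_empty,
    mul_one] at h2
  push_cast at h2
  linarith [mul_div_assoc (2 : ℝ) (3 * Real.log 2) n]

theorem entropy_three_le {h : ℝ}
    (H : Tendsto (fun m : Fin 3 → ℕ => periodicRate D (fun _ => false) m) atTop (𝓝 h))
    {r t : ℕ} (hr : r ≠ 0) (ht : t ≠ 0) : h ≤ logBeta₂ D (2 * r) (2 * t) / (4 * r * t) := by
  -- Directions 2 and 1 get the periods 2t and 2r in turn, then direction 0 is transferred along;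
  -- each costs 3 log 2 / n.
  refine le_of_periodicRate_diagonal_le D (C := 3 * (3 * Real.log 2)) H fun n hn => ?_
  have h1 := periodicRate_le_periodicRate D (per := fun _ => false) (per' := ![false, false, true])
    (m := fun _ : Fin 3 => n) (m' := ![n, n, 2 * t]) 2 rfl rfl (even_two_mul t) (fun _ => hn)
    (by simp [Fin.forall_fin_succ, hn, ht]) (fun j => by fin_cases j <;> rfl)
    (fun j => by fin_cases j <;> rfl)
  have h2 := periodicRate_le_periodicRate D (per := ![false, false, true])
    (per' := ![false, true, true]) (m := ![n, n, 2 * t]) (m' := ![n, 2 * r, 2 * t]) 1 rfl rfl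
    (even_two_mul r) (by simp [Fin.forall_fin_succ, hn, ht])
    (by simp [Fin.forall_fin_succ, hn, ht, hr]) (fun j => by fin_cases j <;> rfl)
    (fun j => by fin_cases j <;> rfl)
  have h3 := periodicRate_le_logRadius D (per := ![false, true, true]) (m := ![n, 2 * r, 2 * t])
    (per' := fun _ => true) (m' := ![2 * r, 2 * t]) 0 rfl
    (by simp [Fin.forall_fin_succ, hn, ht, hr]) (fun j => by fin_cases j <;> rfl)
    (fun j => by fin_cases j <;> rfl)
  rw [← logBeta₂_of_ne_zero D (by omega) (by omega)] at h3
  simp only [Fin.prod_univ_two, Matrix.cons_val_zero, Matrix.cons_val_one] at h2 h3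
  push_cast at h3
  rw [show (2 : ℝ) * r * (2 * t) = 4 * r * t by ring] at h3
  linarith [mul_div_assoc (3 : ℝ) (3 * Real.log 2) n]

theorem le_entropy_two {h : ℝ}
    (H : Tendsto (fun m : Fin 2 → ℕ => periodicRate D (fun _ => false) m) atTop (𝓝 h))
    {p : ℕ} (hp : p ≠ 0) (q : ℕ) : (logBeta₁ D (p + 2 * q) - logBeta₁ D (2 * q)) / p ≤ h := by
  have hp0 : (0 : ℝ) < p := Nat.cast_pos.2 (Nat.pos_of_ne_zero hp)
  rw [div_le_iff₀ hp0, mul_comm h, ← add_zero ((p : ℝ) * h)]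
  refine le_of_le_periodicRate_diagonal D (C := 2 * q * Real.log 2) H fun x hx hx' => ?_
  rw [add_zero]
  exact logBeta₁_lower_bound D hx hx' hp q

theorem le_entropy_three {h : ℝ}
    (H : Tendsto (fun m : Fin 3 → ℕ => periodicRate D (fun _ => false) m) atTop (𝓝 h))
    {p u v : ℕ} (hp : p ≠ 0) (hu : u ≠ 0) (hv : v ≠ 0) (q s : ℕ) :
    (logBeta₂ D (p + 2 * q) (u + 2 * s) - logBeta₂ D (p + 2 * q) (2 * s)) / (u * p) -
      logBeta₂ D (2 * q) (2 * v) / (2 * v * p) ≤ h := by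
  have hp0 : (0 : ℝ) < p := Nat.cast_pos.2 (Nat.pos_of_ne_zero hp)
  have hu0 : (0 : ℝ) < u := Nat.cast_pos.2 (Nat.pos_of_ne_zero hu)
  have hv0 : (0 : ℝ) < v := Nat.cast_pos.2 (Nat.pos_of_ne_zero hv)
  have key : logBeta₂ D (p + 2 * q) (u + 2 * s) - logBeta₂ D (p + 2 * q) (2 * s) ≤
      u * p * h + u * (logBeta₂ D (2 * q) (2 * v) / (2 * v)) := by
    refine le_of_le_periodicRate_diagonal D
      (C := (u * (2 * q + 2 * q) + (p + 2 * q) * (2 * s)) * Real.log 2) H fun x hx hx' => ?_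
    have := logBeta₂_lower_bound D hx hx' hp hu hv q s
    linarith
  have e : logBeta₂ D (2 * q) (2 * v) / (2 * v * p) =
      u * (logBeta₂ D (2 * q) (2 * v) / (2 * v)) / (u * p) := by
    field_simp
  rw [e, ← sub_div, div_le_iff₀ (mul_pos hu0 hp0)]
  linarith

end Limits

/-! ### Translation to the original definitions and conclusion -/

theorem monomerDimerRate_eq {d : ℕ} (m : Fin d → ℕ) :
    monomerDimerRate m = periodicRate False (fun _ => false) m := by
  rw [monomerDimerRate, periodicRate, monomerDimerCovers_eq]

theorem dimerRate_eq {d : ℕ} (m : Fin d → ℕ) :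
    dimerRate m = periodicRate True (fun _ => false) m := by
  rw [dimerRate, periodicRate, dimerCovers_eq]

theorem tendsto_monomerDimerEntropy (d : ℕ) :
    Tendsto (fun m : Fin (d + 1) → ℕ => monomerDimerRate m) atTop
      (𝓝 (monomerDimerEntropy (d + 1))) := by
  refine tendsto_nhds_limUnder ?_
  simp only [monomerDimerRate_eq]
  exact exists_tendsto_periodicRate False d

theorem tendsto_dimerEntropy (d : ℕ) :
    Tendsto (fun m : Fin (d + 1) → ℕ => dimerRate m) atTop (𝓝 (dimerEntropy (d + 1))) := by
  refine tendsto_nhds_limUnder ?_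
  simp only [dimerRate_eq]
  exact exists_tendsto_periodicRate True d

theorem log_beta₁ (m : ℕ) : Real.log (beta₁ m) = logBeta₁ False m := by
  rw [beta₁, logBeta₁, logRadius, transferMatrix_eq]
  split_ifs <;> rfl

theorem log_dimerBeta₁ (m : ℕ) : Real.log (dimerBeta₁ m) = logBeta₁ True m := by
  rw [dimerBeta₁, logBeta₁, logRadius, dimerTransferMatrix_eq]
  split_ifs <;> rfl

theorem log_beta₂ (m n : ℕ) : Real.log (beta₂ m n) = logBeta₂ False m n := by
  rw [beta₂, logBeta₂, logRadius, transferMatrix_eq]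
  split_ifs
  · exact Real.log_pow _ _
  · exact Real.log_pow _ _
  · rfl

theorem log_dimerBeta₂ (m n : ℕ) : Real.log (dimerBeta₂ m n) = logBeta₂ True m n := by
  rw [dimerBeta₂, logBeta₂, logRadius, dimerTransferMatrix_eq]
  split_ifs
  · exact Real.log_pow _ _
  · exact Real.log_pow _ _
  · rfl

theorem theorem6p6 :
    -- The limits defining the four entropies exist.
    (Tendsto (fun m : Fin 2 → ℕ => monomerDimerRate m) atTop (𝓝 (monomerDimerEntropy 2)) ∧
      Tendsto (fun m : Fin 2 → ℕ => dimerRate m) atTop (𝓝 (dimerEntropy 2)) ∧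
      Tendsto (fun m : Fin 3 → ℕ => monomerDimerRate m) atTop (𝓝 (monomerDimerEntropy 3)) ∧
      Tendsto (fun m : Fin 3 → ℕ => dimerRate m) atTop (𝓝 (dimerEntropy 3))) ∧
    -- The conventions for vanishing arguments.
    (beta₁ 0 = 2 ∧ dimerBeta₁ 0 = 2 ∧
      ∀ n : ℕ, 1 ≤ n → beta₂ n 0 = 2 ^ n ∧ beta₂ 0 n = 2 ^ n ∧
        dimerBeta₂ n 0 = 2 ^ n ∧ dimerBeta₂ 0 n = 2 ^ n) ∧
    -- The bounds.
    ∀ p r t u v q s : ℕ, 1 ≤ p → 1 ≤ r → 1 ≤ t → 1 ≤ u → 1 ≤ v →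
      (monomerDimerEntropy 2 ≤ Real.log (beta₁ (2 * r)) / (2 * r) ∧
        (Real.log (beta₁ (p + 2 * q)) - Real.log (beta₁ (2 * q))) / p ≤ monomerDimerEntropy 2) ∧
      (dimerEntropy 2 ≤ Real.log (dimerBeta₁ (2 * r)) / (2 * r) ∧
        (Real.log (dimerBeta₁ (p + 2 * q)) - Real.log (dimerBeta₁ (2 * q))) / p
          ≤ dimerEntropy 2) ∧
      (monomerDimerEntropy 3 ≤ Real.log (beta₂ (2 * r) (2 * t)) / (4 * r * t) ∧
        (Real.log (beta₂ (p + 2 * q) (u + 2 * s)) - Real.log (beta₂ (p + 2 * q) (2 * s))) / (u * p)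
            - Real.log (beta₂ (2 * q) (2 * v)) / (2 * v * p)
          ≤ monomerDimerEntropy 3) ∧
      (dimerEntropy 3 ≤ Real.log (dimerBeta₂ (2 * r) (2 * t)) / (4 * r * t) ∧
        (Real.log (dimerBeta₂ (p + 2 * q) (u + 2 * s))
              - Real.log (dimerBeta₂ (p + 2 * q) (2 * s))) / (u * p)
            - Real.log (dimerBeta₂ (2 * q) (2 * v)) / (2 * v * p)
          ≤ dimerEntropy 3) := by
  refine ⟨⟨tendsto_monomerDimerEntropy 1, tendsto_dimerEntropy 1, tendsto_monomerDimerEntropy 2,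
    tendsto_dimerEntropy 2⟩, ⟨by simp [beta₁], by simp [dimerBeta₁], fun n hn => ?_⟩, ?_⟩
  · have hn' : n ≠ 0 := by omega
    simp [beta₂, dimerBeta₂, hn']
  · intro p r t u v q s hp hr ht hu hv
    rw [Nat.one_le_iff_ne_zero] at hp hr ht hu hv
    have H1 := tendsto_monomerDimerEntropy 1
    have H2 := tendsto_dimerEntropy 1
    have H3 := tendsto_monomerDimerEntropy 2
    have H4 := tendsto_dimerEntropy 2
    simp only [monomerDimerRate_eq, dimerRate_eq] at H1 H2 H3 H4
    simp only [log_beta₁, log_dimerBeta₁, log_beta₂, log_dimerBeta₂]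
    exact ⟨⟨entropy_two_le _ H1 hr, le_entropy_two _ H1 hp q⟩,
      ⟨entropy_two_le _ H2 hr, le_entropy_two _ H2 hp q⟩,
      ⟨entropy_three_le _ H3 hr ht, le_entropy_three _ H3 hp hu hv q s⟩,
      ⟨entropy_three_le _ H4 hr ht, le_entropy_three _ H4 hp hu hv q s⟩⟩
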